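/- Let $N\ge 1$ be an integer. **Colored permutations.** $C_N\wr S_n$ is the set of words $\pi=\pi_1\cdots\pi_n$ with $\pi_i=|\pi_i|^{\epsilon_i}$, $\epsilon_i\in\{0,\dots,N-1\}$ and $|\pi|=|\pi_1|\cdots|\pi_n|\in S_n$. Colored integers are ordered by $a^c<b^d$ iff $c>d$, or $c=d$ and $a<b$. Put $\mathrm{EXC}(\pi)=\{i:\pi_i>i^0\}$ and $\mathrm{exc}(\pi)=|\mathrm{EXC}(\pi)|$. Let $\widetilde\pi$ be obtained from $\pi$ by replacing $\pi_i$ by $\widetilde{\pi_i}$ for $i\in\mathrm{EXC}(\pi)$, where the letters $\widetilde{1^0}<\widetilde{2^0}<\cdots$ are smaller than all letters without a tilde, and let $\mathrm{DEX}(\pi)=\{i\in[n-1]:\widetilde\pi_i>\widetilde\pi_{i+1}\}$. The color vector of a finite collection of colored letters is $\vec\beta\in\mathbb N^{N-1}$, where $\beta_m$ is the number of letters of color $m$ $(1\le m\le N-1)$. The cv-cycle type of $\pi$ is the multiset of pairs (length, color vector) of the cycles of $\pi$, fixed points included. For $T\subseteq[n-1]$ let $$F_{T,n}=\sum_{\substack{i_1\ge\cdots\ge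 i_n\ge1\\ i_k>i_{k+1}\text{ if }k\in T}}x_{i_1}\cdots x_{i_n}.$$ For a finite multiset $\check\lambda=\{(\lambda_1,\vec{\beta^1}),\dots,(\lambda_k,\vec{\beta^k})\}$ of pairs in $\mathbb N\times\mathbb N^{N-1}$, $n=\lambda_1+\dots+\lambda_k$, and $j\in\mathbb N$, let $Q_{\check\lambda,j}=\sum_\pi F_{\mathrm{DEX}(\pi),n}$, the sum over all $\pi\in C_N\wr S_n$ of cv-cycle type $\check\lambda$ with $\mathrm{exc}(\pi)=j$. **Letters.** Let $\mathcal B$ consist of the letters $u^m$ (unbarred, color $m$) and $\overline{u^0}$ (barred, color $0$) for $u\ge1$ and $0\le m\le N-1$, all with absolute value $u$. The weight of a finite word over $\mathcal B$, and of a circular word, is the product of the $x_{|b|}$ over its letters $b$. **Ornaments.** A colored necklace is a circular word over $\mathcal B$ (a class of words under rotation) which is primitive (the class has as many elements as the word has letters) and in which (1) every barred letter is followed cyclically by a letter of lesser or equal absolute value, (2) every $0$-colored unbarred letter is followed cyclically by a letter of greater or equal absolute value, and (3) the word is not a single barred letter. A colored ornament is a finite multiset of colored necklaces; its weight is the product of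 the weights of its necklaces and its cv-cycle type is the multiset of pairs (length, color vector) of its necklaces. Let $\mathcal R(\check\lambda,j)$ be the set of colored ornaments of cv-cycle type $\check\lambda$ with exactly $j$ barred letters. **Banners.** A colored banner is a finite word $B$ over $\mathcal B$ such that (1) a barred letter is never followed by a letter of larger absolute value, (2) a $0$-colored unbarred letter is never followed by a letter of smaller absolute value, and (3) the last letter (if any) is unbarred. Order $\mathcal B$ by $<_B$: all letters of positive color precede all $0$-colored letters; letters of positive color are ordered by absolute value and then by color; and $1^0<_B\overline{1^0}<_B2^0<_B\overline{2^0}<_B\cdots$. A Lyndon word is a nonempty word that is strictly lexicographically larger, with respect to $<_B$, than all its proper rotations. The Lyndon factorization of a word is its factorization into a lexicographically weakly increasing sequence of Lyndon words, where a proper prefix of a word counts as larger than the word. The cv-cycle type of $B$ is the multiset of pairs (length, color vector) of the factors in its Lyndon factorization. Let $K(\check\lambda,j)$ be the set of colored banners of cv-cycle type $\check\lambda$ with exactly $j$ barred letters. **Theorem.** For all $\check\lambda$ and $j$ there is a weight-preserving bijection from $\mathcal R(\check\lambda,j)$ to $K(\check\lambda,j)$. Consequently, $$Q_{\check\lambda,j}=\sum_{B\in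 K(\check\lambda,j)}\mathrm{wt}(B)$$ as formal power series in $x_1,x_2,\dots$ over $\mathbb Z$, the sum converging coefficientwise. -/

import Mathlib

open scoped MvPowerSeries.WithPiTopology

noncomputable section

namespace ColoredEulerian

/-! ### Colored permutations and colored Eulerian quasisymmetric functions -/

/-- A colored permutation in `C_N ≀ S_n`: the word whose `i`-th letter is `|π_i|^{ε_i}` is given by
the permutation `|π| = π.1` and the colors `ε = π.2`.  Positions and letters are indexed from `0`. -/
abbrev ColoredPerm (N n : ℕ) : Type := Equiv.Perm (Fin n) × (Fin n → Fin N)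

/-- The alphabet `𝓔` of colored integers: `a^c < b^d` iff `c > d`, or `c = d` and `a < b`. -/
abbrev ColoredInt (N n : ℕ) : Type := (Fin N)ᵒᵈ ×ₗ Fin n

/-- The letter `a^c` of `𝓔`. -/
def coloredInt {N n : ℕ} (a : Fin n) (c : Fin N) : ColoredInt N n := toLex (OrderDual.toDual c, a)

/-- The alphabet `𝓐`: the letters `ã` with a tilde, in their natural order, all smaller than the
letters of `𝓔`. -/
abbrev TildeAlphabet (N n : ℕ) : Type := Fin n ⊕ₗ ColoredInt N n

namespace ColoredPerm

variable {N n : ℕ}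

/-- The `i`-th letter `π_i ∈ 𝓔` of a colored permutation. -/
def letter (π : ColoredPerm N n) (i : Fin n) : ColoredInt N n := coloredInt (π.1 i) (π.2 i)

/-- `EXC(π) = {i : π_i > i^0}`. -/
def EXC [NeZero N] (π : ColoredPerm N n) : Finset (Fin n) :=
  Finset.univ.filter fun i => coloredInt i 0 < letter π i

/-- The excedance number. -/
def exc [NeZero N] (π : ColoredPerm N n) : ℕ := (EXC π).card

/-- The word `π̃`, obtained by putting a tilde on the letters in excedance positions. -/
def tilde [NeZero N] (π : ColoredPerm N n) (i : Fin n) : TildeAlphabet N n :=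
  if i ∈ EXC π then Sum.inlₗ (π.1 i) else Sum.inrₗ (letter π i)

/-- `DEX(π)`, the descent set of `π̃`. -/
def DEX [NeZero N] (π : ColoredPerm N n) : Set (Fin n) :=
  {i | ∃ h : (i : ℕ) + 1 < n, tilde π ⟨(i : ℕ) + 1, h⟩ < tilde π i}

/-- The underlying sets of the cycles of a permutation, fixed points included. -/
def cycleSets (σ : Equiv.Perm (Fin n)) : Finset (Finset (Fin n)) :=
  Finset.univ.image fun i => Finset.univ.filter fun k => σ.SameCycle i k

/-- The cv-cycle type of a colored permutation: the multiset of pairs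
(length, color vector) of its cycles.  Coordinate `m` of a color vector belongs to color `m + 1`. -/
def cvCycleType (π : ColoredPerm N n) : Multiset (ℕ × (Fin (N - 1) → ℕ)) :=
  (cycleSets π.1).val.map fun c =>
    (c.card, fun m => (c.filter fun i => (π.2 i : ℕ) = (m : ℕ) + 1).card)

end ColoredPerm

/-- The index set of the fundamental quasisymmetric function `F_{T,n}`: weakly decreasing
sequences of `n` positive integers with a strict decrease after each position in `T`. -/
def IsCompatible {n : ℕ} (T : Set (Fin n)) (s : Fin n → ℕ+) : Prop :=
  Antitone s ∧ ∀ i ∈ T, ∀ h : (i : ℕ) + 1 < n, s ⟨(i : ℕ) + 1, h⟩ < s i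

/-- The fundamental quasisymmetric function `F_{T,n}`, a formal power series in `x_1, x_2, …`;
the infinite sum is taken in the topology of coefficientwise (eventually constant) convergence,
and it converges by `summable_fundamental`. -/
def fundamental (n : ℕ) (T : Set (Fin n)) : MvPowerSeries ℕ+ ℤ :=
  ∑' s : {s : Fin n → ℕ+ // IsCompatible T s}, ∏ i, MvPowerSeries.X (s.1 i)

theorem summable_fundamental (n : ℕ) (T : Set (Fin n)) :
    Summable fun s : {s : Fin n → ℕ+ // IsCompatible T s} =>
      (∏ i, MvPowerSeries.X (s.1 i) : MvPowerSeries ℕ+ ℤ) := by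
  have hprod : ∀ s : Fin n → ℕ+, (∏ i, MvPowerSeries.X (s i) : MvPowerSeries ℕ+ ℤ) =
      MvPowerSeries.monomial (∑ i, Finsupp.single (s i) 1) 1 := by
    intro s
    simp only [MvPowerSeries.X]
    rw [MvPowerSeries.prod_monomial]
    simp
  have key : ∀ d : ℕ+ →₀ ℕ, Summable fun s : {s : Fin n → ℕ+ // IsCompatible T s} =>
      MvPowerSeries.coeff d (∏ i, MvPowerSeries.X (s.1 i) : MvPowerSeries ℕ+ ℤ) := by
    intro d
    apply summable_of_hasFiniteSupport
    have hfin : {s : Fin n → ℕ+ | ∀ i, s i ∈ (d.support : Set ℕ+)}.Finite := by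
      have := Set.Finite.pi' (fun _ : Fin n => d.support.finite_toSet)
      exact this
    refine (hfin.preimage (f := Subtype.val) Subtype.val_injective.injOn).subset ?_
    intro s hs i
    rw [Function.mem_support, hprod, MvPowerSeries.coeff_monomial] at hs
    have hd : d = ∑ i, Finsupp.single (s.1 i) 1 := by
      by_contra h
      exact hs (if_neg h)
    rw [Finset.mem_coe, Finsupp.mem_support_iff, hd, Finsupp.finsetSum_apply]
    have : 1 ≤ ∑ k, (Finsupp.single (s.1 k) 1 : ℕ+ →₀ ℕ) (s.1 i) := by
      refine le_trans ?_ (Finset.single_le_sum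
        (f := fun k => (Finsupp.single (s.1 k) 1 : ℕ+ →₀ ℕ) (s.1 i))
        (fun _ _ => Nat.zero_le _) (Finset.mem_univ i))
      simp
    omega
  exact Pi.summable.2 key

/-- The cv-cycle type colored Eulerian quasisymmetric function `Q_{λ̌,j}`: the sum of
`F_{DEX(π),n}` over all `π ∈ C_N ≀ S_n` of cv-cycle type `λ̌` with `j` excedances, where `n` is the
sum of the parts of `λ̌`. -/
def Q (N : ℕ) [NeZero N] (lam : Multiset (ℕ × (Fin (N - 1) → ℕ))) (j : ℕ) :
    MvPowerSeries ℕ+ ℤ :=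
  ∑ π : ColoredPerm N (lam.map Prod.fst).sum with π.cvCycleType = lam ∧ π.exc = j,
    fundamental (lam.map Prod.fst).sum π.DEX

/-! ### The alphabet `𝓑` -/

/-- The alphabet `𝓑`: `unbarred a m` is `a^m` and `barred a` is the barred letter on `a^0`. -/
inductive Letter (N : ℕ) : Type
  | unbarred (a : ℕ+) (m : Fin N)
  | barred (a : ℕ+)

namespace Letter

variable {N : ℕ}

/-- The absolute value. -/
def abs : Letter N → ℕ+
  | unbarred a _ => a
  | barred a => a

/-- The color; barred letters are `0`-colored. -/
def color : Letter N → ℕ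
  | unbarred _ m => m
  | barred _ => 0

/-- Whether the letter is barred. -/
def isBarred : Letter N → Bool
  | unbarred _ _ => false
  | barred _ => true

/-- Sort key for the order `<_B`: the letters of positive color come before all the `0`-colored
letters; positively colored letters are ordered by absolute value, then by color, and `0`-colored
letters by absolute value, the unbarred letter before the barred one. -/
def key (x : Letter N) : ℕ ×ₗ ℕ ×ₗ ℕ :=
  toLex (if x.color = 0 then 1 else 0,
    toLex ((x.abs : ℕ), if x.isBarred then 1 else x.color))

theorem key_injective : Function.Injective (key : Letter N → ℕ ×ₗ ℕ ×ₗ ℕ) := by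
  intro x y h
  simp only [key, EmbeddingLike.apply_eq_iff_eq, Prod.mk.injEq] at h
  obtain ⟨h1, h2, h3⟩ := h
  have h2' := PNat.coe_injective h2
  rcases x with ⟨a, m⟩ | a <;> rcases y with ⟨b, k⟩ | b
  · obtain rfl : a = b := h2'
    obtain rfl : m = k := Fin.ext h3
    rfl
  · have hm : (unbarred a m).color = 0 := by
      by_contra hm
      rw [if_neg hm] at h1
      exact absurd h1 (by simp [color])
    exact absurd (hm.symm.trans h3) (by simp [isBarred])
  · have hk : (unbarred b k).color = 0 := by
      by_contra hk
      rw [if_neg hk] at h1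
      exact absurd h1 (by simp [color])
    exact absurd (h3.trans hk) (by simp [isBarred])
  · obtain rfl : a = b := h2'
    rfl

/-- The order `<_B` on the alphabet `𝓑`. -/
instance : LinearOrder (Letter N) := LinearOrder.lift' key key_injective

/-- The common adjacency rule of colored necklaces and colored banners, for a letter `x` followed by
`y`: if `x` is barred then `|x| ≥ |y|`; if `x` is `0`-colored and unbarred then `|x| ≤ |y|`. -/
def Follows (x y : Letter N) : Prop :=
  (x.isBarred = true → y.abs ≤ x.abs) ∧ (x.color = 0 ∧ x.isBarred = false → x.abs ≤ y.abs)

end Letter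

/-! ### Statistics depending only on the multiset of letters of a (circular) word -/

variable {N : ℕ}

/-- The weight `∏ x_{|v_i|}`. -/
def wt (s : Multiset (Letter N)) : MvPowerSeries ℕ+ ℤ :=
  (s.map fun x => MvPowerSeries.X x.abs).prod

/-- The number of barred letters. -/
def bars (s : Multiset (Letter N)) : ℕ := s.countP fun x => x.isBarred = true

/-- The pair (length, color vector); coordinate `m` of the color vector counts the letters of
color `m + 1`. -/
def lengthCol (s : Multiset (Letter N)) : ℕ × (Fin (N - 1) → ℕ) :=
  (s.card, fun m => s.countP fun x => x.color = (m : ℕ) + 1)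

/-! ### Colored necklaces and ornaments -/

/-- A circular word (a rotation class of words) is primitive if the class has as many
elements as the length of the word. -/
def IsPrimitive (c : Cycle (Letter N)) : Prop :=
  Set.ncard {v : List (Letter N) | (v : Cycle (Letter N)) = c} = c.length

/-- A colored necklace: a primitive circular word over `𝓑` in which every letter is followed
(cyclically) by an admissible one and which is not a single barred letter. -/
def IsNecklace (c : Cycle (Letter N)) : Prop :=
  IsPrimitive c ∧ c.Chain Letter.Follows ∧
    ∀ a : ℕ+, c ≠ (([Letter.barred a] : List (Letter N)) : Cycle (Letter N))

/-- The type of colored necklaces. -/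
abbrev Necklace (N : ℕ) : Type := {c : Cycle (Letter N) // IsNecklace c}

/-- A colored ornament is a multiset of colored necklaces. -/
abbrev Ornament (N : ℕ) : Type := Multiset (Necklace N)

/-- The weight of an ornament: the product of the weights of its necklaces. -/
def Ornament.weight (R : Ornament N) : MvPowerSeries ℕ+ ℤ :=
  (R.map fun c => wt c.1.toMultiset).prod

/-- The cv-cycle type of an ornament. -/
def Ornament.cvCycleType (R : Ornament N) : Multiset (ℕ × (Fin (N - 1) → ℕ)) :=
  R.map fun c => lengthCol c.1.toMultiset

/-- The number of barred letters of an ornament. -/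
def Ornament.numBars (R : Ornament N) : ℕ := (R.map fun c => bars c.1.toMultiset).sum

/-- `𝓡(λ̌, j)`: the ornaments of cv-cycle type `λ̌` with exactly `j` barred letters. -/
def ornaments (lam : Multiset (ℕ × (Fin (N - 1) → ℕ))) (j : ℕ) : Set (Ornament N) :=
  {R | R.cvCycleType = lam ∧ R.numBars = j}

/-! ### Lyndon factorization and colored banners -/

/-- A Lyndon word: a nonempty word that is strictly lexicographically larger (with respect to
`<_B`) than all its proper circular rearrangements. -/
def IsLyndon (w : List (Letter N)) : Prop :=
  w ≠ [] ∧ ∀ k, 0 < k → k < w.length → w.rotate k < w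

/-- The lexicographic order `u ≤ v` used in Lyndon factorizations.  As Lyndon words are *largest*
among their rotations, it is the reverse of the dictionary order over the reversed
alphabet: words are compared at the first position where they differ, with respect to `<_B`, and a
proper prefix of a word is *larger* than the word.  This is the convention under which
every word has exactly one Lyndon factorization. -/
def LexLE (u v : List (Letter N)) : Prop :=
  u = v ∨ List.Lex (fun a b => b < a) v u

/-- `L` is the Lyndon factorization of the word `w`: the words in `L` are Lyndon, weakly increase
lexicographically, and their concatenation is `w`. -/
def IsLyndonFactorization (L : List (List (Letter N))) (w : List (Letter N)) : Prop :=
  (∀ l ∈ L, IsLyndon l) ∧ L.Pairwise LexLE ∧ L.flatten = w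

/-- A colored banner. -/
def IsBanner (B : List (Letter N)) : Prop :=
  B.IsChain Letter.Follows ∧ ∀ a : ℕ+, B.getLast? ≠ some (Letter.barred a)

/-- The word `B` has cv-cycle type `λ̌`: the pairs (length, color vector) of the factors in its
Lyndon factorization form the multiset `λ̌`. -/
def HasCvCycleType (B : List (Letter N)) (lam : Multiset (ℕ × (Fin (N - 1) → ℕ))) : Prop :=
  ∃ L : List (List (Letter N)), IsLyndonFactorization L B ∧
    ((L.map fun l => lengthCol (l : Multiset (Letter N))) : Multiset _) = lam

/-- `K(λ̌, j)`: the banners of cv-cycle type `λ̌` with exactly `j` barred letters. -/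
def banners (lam : Multiset (ℕ × (Fin (N - 1) → ℕ))) (j : ℕ) : Set (List (Letter N)) :=
  {B | IsBanner B ∧ HasCvCycleType B lam ∧ bars (B : Multiset (Letter N)) = j}

end ColoredEulerian

end

noncomputable section

namespace ColoredEulerian

/-! ### Words that are smaller than their rotations in the dictionary order -/

section Dictionary

variable {β : Type*} [LinearOrder β]

/-! Two bijections are composed.

Ornaments and banners: a primitive circular word has exactly one Lyndon rotation. Sorting and
concatenating these rotations gives a word, and unique Lyndon factorization
(`IsLyndonFactorization.unique`) recovers the ornament. The two adjacency conditions agree because a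
Lyndon word begins with its largest letter. At a wrap-around or a junction of factors, the last
letter `x` therefore meets a letter `y ≥ x`. If `x` is unbarred, the rule holds for free
(`Letter.follows_of_le`); if `x` is barred, it forces `x = y` (`Letter.eq_of_barred_le`), which in
the end only a single barred letter could satisfy. Hence `IsLyndon.isNecklace_iff`,
`isBanner_flatten` and `isBanner_of_mem_factorization`.

Compatible pairs and ornaments, in the manner of Gessel and Reutenauer: given `π` and a
`DEX(π)`-compatible sequence `s`, label position `i` by a letter of absolute value `s i` and color
`ε_i`, barred at excedances, and read the labels along the cycles. Compatibility means that the
labelled permutation is standard (`isCompatible_iff_isStandard`). Standardness makes the circular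
words necklaces. Conversely, the positions of an ornament, sorted by the infinite words read from
them with ties broken by the index of the necklace, carry a standard permutation
(`exists_isStandard`). It is the only one, since the circular words determine the sorted list of
infinite words and this list determines the permutation (`IsStandard.eq_of_cycleWords_eq`).

Both bijections preserve weight, and `Q` expands into the sum of the weights of the pairs. -/

theorem prefix_or_append_lt {u v : List β} (h : u < v) :
    u <+: v ∨ ∀ x y : List β, u ++ x < v ++ y := by
  induction h with
  | nil => exact Or.inl (List.nil_prefix)
  | rel h => exact Or.inr fun x y => List.Lex.rel h
  | cons h ih =>
    rcases ih with ih | ih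
    · exact Or.inl ((List.prefix_cons_inj _).2 ih)
    · exact Or.inr fun x y => List.Lex.cons (ih x y)

theorem append_lt_append_left_iff (w : List β) {u v : List β} : w ++ u < w ++ v ↔ u < v := by
  induction w with
  | nil => rfl
  | cons a w ih => simpa using ih

theorem lt_of_prefix_of_ne {u v : List β} (h : u <+: v) (hne : u ≠ v) : u < v := by
  obtain ⟨t, rfl⟩ := h
  cases t with
  | nil => simp at hne
  | cons a t =>
    conv_lhs => rw [← List.append_nil u]
    exact (append_lt_append_left_iff u).2 List.Lex.nil

/-- A nonempty word that is smaller than all its proper rotations. -/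
def IsMinRotation (w : List β) : Prop :=
  w ≠ [] ∧ ∀ k, 0 < k → k < w.length → w < w.rotate k

/-- Suppose `v < u ++ v`. If they differ at a letter of `v`, then the rotation `v ++ u` is already
below `u ++ v`. Otherwise `u ++ v = v ++ z`; comparison with the rotation `v ++ u` gives `z < u`
with equal lengths, so the rotation `z ++ v` is too small. -/
theorem IsMinRotation.lt_suffix {u v : List β} (h : IsMinRotation (u ++ v)) (hu : u ≠ [])
    (hv : v ≠ []) : u ++ v < v := by
  have hul := List.length_pos_iff.2 hu
  have hvl := List.length_pos_iff.2 hv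
  by_contra hlt
  have hne : v ≠ u ++ v := by
    intro he
    have := congrArg List.length he
    rw [List.length_append] at this
    omega
  have hlt : v < u ++ v := lt_of_le_of_ne (not_lt.1 hlt) hne
  have hrot : u ++ v < v ++ u := by
    have := h.2 u.length hul (by simp; omega)
    rwa [List.rotate_append_length_eq] at this
  rcases prefix_or_append_lt hlt with ⟨z, hz⟩ | hlt
  · have hz1 : z < u := by
      rw [← hz] at hrot
      exact (append_lt_append_left_iff v).1 hrot
    have hlen : z.length = u.length := by
      have := congrArg List.length hz
      simp at this
      omega
    have hrot' : u ++ v < z ++ v := by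
      have := h.2 v.length hvl (by simp; omega)
      rw [← hz, List.rotate_append_length_eq, hz] at this
      exact this
    rcases prefix_or_append_lt hz1 with hp | hp
    · exact absurd (hp.eq_of_length hlen) hz1.ne
    · exact absurd (hp v v) hrot'.not_gt
  · have := hlt u []
    rw [List.append_nil] at this
    exact absurd this hrot.not_gt

/-- The word `p` is the part of `t` inside the factor in which `t` ends. -/
theorem exists_suffix_prefix_of_prefix_flatten {γ : Type*} {t : List γ} (ht : t ≠ [])
    {L : List (List γ)}
    (h : t <+: L.flatten) : ∃ s p : List γ, t = s ++ p ∧ p ≠ [] ∧ ∃ l ∈ L, p <+: l := by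
  induction L generalizing t with
  | nil => exact absurd (List.prefix_nil.1 h) ht
  | cons l L ih =>
    rw [List.flatten_cons] at h
    obtain ⟨z, hz⟩ := h
    rcases List.append_eq_append_iff.1 hz with ⟨t', h, -⟩ | ⟨t', rfl, h⟩
    · exact ⟨[], t, rfl, ht, l, by simp, h ▸ List.prefix_append _ _⟩
    · by_cases ht' : t' = []
      · subst ht'
        exact ⟨[], l ++ [], rfl, ht, l, by simp, by simp⟩
      · obtain ⟨s, p, rfl, hp, l', hl', hpl⟩ := ih ht' ⟨z, h.symm⟩
        exact ⟨l ++ s, p, by simp, hp, l', by simp [hl'], hpl⟩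

/-- This excludes first factors `l` and `l ++ t` of different lengths. The overhang `t` ends with a
nonempty prefix `p` of some factor `l' ≤ l`, and `p` is a proper suffix of `l ++ t`, so `l ++ t < p
≤ l' ≤ l < l ++ t`. -/
theorem not_proper_prefix_of_flatten_eq {l t : List β} {L M : List (List β)}
    (hl : l ≠ []) (ht : t ≠ []) (hm : IsMinRotation (l ++ t)) (hs : ∀ l' ∈ L, l' ≤ l)
    (h : L.flatten = t ++ M.flatten) : False := by
  obtain ⟨s, p, rfl, hp, l', hl', hpl⟩ :=
    exists_suffix_prefix_of_prefix_flatten ht (L := L) (h ▸ List.prefix_append _ _)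
  have h1 : l ++ (s ++ p) < p := by
    rw [← List.append_assoc] at hm ⊢
    exact hm.lt_suffix (by simp [hl]) hp
  have h2 : p ≤ l' := by
    by_cases he : p = l'
    · exact he.le
    · exact (lt_of_prefix_of_ne hpl he).le
  have h3 : l < l ++ (s ++ p) := lt_of_prefix_of_ne (List.prefix_append _ _) (by simpa using ht)
  exact absurd ((h1.trans_le h2).trans_le (hs l' hl')) h3.not_gt

/-- A word has at most one factorization into a weakly decreasing sequence of words each of which
is smaller than its proper rotations. -/
theorem factorization_unique {L M : List (List β)} (hL : ∀ l ∈ L, IsMinRotation l)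
    (hM : ∀ l ∈ M, IsMinRotation l) (hLs : L.Pairwise fun a b => b ≤ a)
    (hMs : M.Pairwise fun a b => b ≤ a) (h : L.flatten = M.flatten) : L = M := by
  induction L generalizing M with
  | nil =>
    cases M with
    | nil => rfl
    | cons m M =>
      have := (hM m (by simp)).1
      simp_all
  | cons l L ih =>
    cases M with
    | nil =>
      have := (hL l (by simp)).1
      simp_all
    | cons m M =>
      rw [List.flatten_cons, List.flatten_cons] at h
      rw [List.pairwise_cons] at hLs hMs
      have hlm : l = m := by
        rcases List.append_eq_append_iff.1 h with ⟨t, rfl, ht⟩ | ⟨t, rfl, ht⟩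
        · by_contra hne
          exact not_proper_prefix_of_flatten_eq (hL l (by simp)).1 (by simpa using hne)
            (hM _ (by simp)) hLs.1 ht
        · by_contra hne
          exact not_proper_prefix_of_flatten_eq (hM m (by simp)).1 (by simpa using hne)
            (hL _ (by simp)) hMs.1 ht
      subst hlm
      rw [ih (fun l hl => hL l (by simp [hl])) (fun l hl => hM l (by simp [hl])) hLs.2 hMs.2
        (List.append_cancel_left h)]

end Dictionary

/-! ### Uniqueness of the Lyndon factorization, by passing to the dual alphabet -/

/-- Words of equal length first differ at a letter, never by one being a proper prefix. For
rotations, "largest over `<_B`" thus becomes "smallest over the dual alphabet". -/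
theorem lex_swap_of_length_eq {α : Type*} {r : α → α → Prop} {u v : List α}
    (h : List.Lex r u v) (hlen : u.length = v.length) : List.Lex (fun a b => r b a) v u := by
  induction h with
  | nil => simp at hlen
  | rel h => exact List.Lex.rel h
  | cons h ih => exact List.Lex.cons (ih (by simpa using hlen))

variable {N : ℕ}

theorem IsLyndon.isMinRotation {w : List (Letter N)} (h : IsLyndon w) :
    IsMinRotation (β := (Letter N)ᵒᵈ) w :=
  ⟨h.1, fun k h0 hk => lex_swap_of_length_eq (h.2 k h0 hk) (List.length_rotate w k)⟩

theorem lexLE_iff {u v : List (Letter N)} :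
    LexLE u v ↔ (show List (Letter N)ᵒᵈ from v) ≤ (show List (Letter N)ᵒᵈ from u) := by
  rw [le_iff_eq_or_lt]
  exact or_congr eq_comm Iff.rfl

theorem IsLyndonFactorization.unique {L M : List (List (Letter N))} {w : List (Letter N)}
    (hL : IsLyndonFactorization L w) (hM : IsLyndonFactorization M w) : L = M :=
  factorization_unique (β := (Letter N)ᵒᵈ) (fun l hl => (hL.1 l hl).isMinRotation)
    (fun l hl => (hM.1 l hl).isMinRotation) (hL.2.1.imp fun h => lexLE_iff.1 h)
    (hM.2.1.imp fun h => lexLE_iff.1 h) (hL.2.2.trans hM.2.2.symm)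

instance : Std.Antisymm (LexLE (N := N)) :=
  ⟨fun u v h h' => le_antisymm (α := List (Letter N)ᵒᵈ) (a := u) (b := v)
    (lexLE_iff.1 h') (lexLE_iff.1 h)⟩

instance : IsTrans _ (LexLE (N := N)) :=
  ⟨fun u v w h h' => lexLE_iff.2 (le_trans (α := List (Letter N)ᵒᵈ) (a := w) (b := v) (c := u)
    (lexLE_iff.1 h') (lexLE_iff.1 h))⟩

instance : Std.Total (LexLE (N := N)) :=
  ⟨fun u v => (le_total (α := List (Letter N)ᵒᵈ) v u).imp lexLE_iff.2 lexLE_iff.2⟩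

/-! ### Letters of Lyndon words -/

theorem IsLyndon.lex_suffix {u v : List (Letter N)} (h : IsLyndon (u ++ v)) (hu : u ≠ [])
    (hv : v ≠ []) : List.Lex (fun a b : Letter N => b < a) (u ++ v) v :=
  IsMinRotation.lt_suffix (β := (Letter N)ᵒᵈ) h.isMinRotation hu hv

theorem LexLE.head_le {x y : Letter N} {u v : List (Letter N)} (h : LexLE (x :: u) (y :: v)) :
    x ≤ y := by
  rcases h with h | h
  · exact (List.cons.inj h).1.le
  · cases h with
    | rel h => exact le_of_lt h
    | cons h => exact le_rfl

theorem IsLyndon.le_head {a : Letter N} {w : List (Letter N)} (h : IsLyndon (a :: w))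
    {x : Letter N} (hx : x ∈ w) : x ≤ a := by
  obtain ⟨s, t, rfl⟩ := List.append_of_mem hx
  have := IsLyndon.lex_suffix (u := a :: s) (v := x :: t) h (by simp) (by simp)
  exact LexLE.head_le (u := t) (v := s ++ x :: t) (Or.inr this)

/-- Otherwise `[a]` would be both a proper suffix and a proper prefix, against
`IsLyndon.lex_suffix`. -/
theorem IsLyndon.getLast_ne_head {a : Letter N} {w : List (Letter N)} (h : IsLyndon (a :: w))
    (hw : w ≠ []) : w.getLast hw ≠ a := by
  intro he
  have h1 := IsLyndon.lex_suffix (u := a :: w.dropLast) (v := [w.getLast hw]) (by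
    rwa [List.cons_append, List.dropLast_append_getLast hw]) (by simp) (by simp)
  rw [List.cons_append, List.dropLast_append_getLast hw, he] at h1
  cases h1 with
  | rel h => exact lt_irrefl _ h
  | cons h => cases h

theorem Letter.le_iff_key {x y : Letter N} : x ≤ y ↔ x.key ≤ y.key := Iff.rfl

theorem Letter.color_of_isBarred {x : Letter N} (h : x.isBarred = true) : x.color = 0 := by
  cases x <;> simp_all [isBarred, color]

theorem Letter.ext_of {x y : Letter N} (h1 : x.abs = y.abs) (h2 : x.color = y.color)
    (h3 : x.isBarred = y.isBarred) : x = y := by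
  cases x <;> cases y <;> simp_all [abs, color, isBarred, Fin.ext_iff]

theorem Letter.zero_color_of_le {x y : Letter N} (h : x ≤ y) (hx : x.color = 0) :
    y.color = 0 ∧ x.abs ≤ y.abs := by
  rw [le_iff_key, key, key, Prod.Lex.le_iff] at h
  simp only [hx, if_true, ofLex_toLex] at h
  have hy : y.color = 0 := by
    by_contra hy
    simp [hy] at h
  refine ⟨hy, ?_⟩
  simp only [hy, if_true, lt_irrefl, true_and, false_or] at h
  rw [Prod.Lex.le_iff] at h
  rcases h with h | h
  · exact le_of_lt (by exact_mod_cast h)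
  · exact le_of_eq (PNat.coe_injective h.1)

/-- The order gives `|x| ≤ |y|` and the adjacency rule `|y| ≤ |x|`; among `0`-colored letters of one
absolute value the barred one is the largest. -/
theorem Letter.eq_of_barred_le {x y : Letter N} (h : x ≤ y) (hx : x.isBarred = true)
    (hf : Follows x y) : x = y := by
  obtain ⟨h1, h2⟩ := zero_color_of_le h (color_of_isBarred hx)
  have habs := le_antisymm h2 (hf.1 hx)
  rw [le_iff_key, key, key, Prod.Lex.le_iff] at h
  simp only [color_of_isBarred hx, h1, if_true, ofLex_toLex, lt_irrefl, true_and, false_or] at h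
  rw [Prod.Lex.le_iff] at h
  simp only [habs, ofLex_toLex, lt_irrefl, true_and, false_or, hx, if_true] at h
  refine ext_of habs (by rw [h1, color_of_isBarred hx]) ?_
  by_contra hy
  have hy' : y.isBarred = false := by
    rw [hx] at hy
    simpa using hy
  simp [hy'] at h

theorem Letter.follows_of_le {x y : Letter N} (h : x ≤ y) (hx : x.isBarred = false) :
    Follows x y :=
  ⟨fun h' => by simp [hx] at h', fun h' => (zero_color_of_le h h'.1).2⟩

end ColoredEulerian

end

noncomputable section

namespace ColoredEulerian

variable {N : ℕ}

/-! ### Primitive circular words -/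

/-- The class is full exactly when the list of the `w.length` rotations has no repetition, and a
repetition at two indices shifts back to one at index `0`. -/
theorem isPrimitive_coe_iff {w : List (Letter N)} (hw : w ≠ []) :
    IsPrimitive (w : Cycle (Letter N)) ↔ ∀ k, 0 < k → k < w.length → w.rotate k ≠ w := by
  have hset : {v : List (Letter N) | (v : Cycle (Letter N)) = w} =
      ((w.cyclicPermutations : Multiset (List (Letter N))).toFinset : Set (List (Letter N))) := by
    ext v
    simp [List.mem_cyclicPermutations_iff]
  have hlen := List.length_cyclicPermutations_of_ne_nil w hw
  rw [IsPrimitive, hset, Set.ncard_coe_finset, Cycle.length_coe]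
  conv_lhs => rw [← hlen, ← Multiset.coe_card]
  rw [Multiset.toFinset_card_eq_card_iff_nodup, Multiset.coe_nodup, List.nodup_iff_injective_get]
  constructor
  · intro h k h0 hk he
    have := @h ⟨k, by omega⟩ ⟨0, by omega⟩ (by simpa using he)
    simp at this
    omega
  · intro h
    have key : ∀ i j : Fin w.cyclicPermutations.length, i < j →
        w.cyclicPermutations.get i ≠ w.cyclicPermutations.get j := by
      intro i j hij he
      rw [List.get_cyclicPermutations, List.get_cyclicPermutations] at he
      have hij' : (i : ℕ) < j := hij
      have hj := j.2
      refine h (j - i) (by omega) (by omega) (List.rotate_eq_rotate (n := i) |>.1 ?_)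
      rw [List.rotate_rotate, Nat.sub_add_cancel hij'.le, he]
    intro i j he
    rcases lt_trichotomy i j with hij | hij | hij
    · exact absurd he (key i j hij)
    · exact hij
    · exact absurd he.symm (key j i hij)

/-- The class of the empty word has one element but length `0`, so the empty word is never a
necklace. -/
theorem not_isPrimitive_nil : ¬ IsPrimitive (Cycle.nil : Cycle (Letter N)) := by
  intro h
  have hset : {v : List (Letter N) | (v : Cycle (Letter N)) = Cycle.nil} = {[]} := by
    ext v
    simp
  rw [IsPrimitive, hset] at h
  simp at h

theorem IsNecklace.ne_nil {w : List (Letter N)} (h : IsNecklace (w : Cycle (Letter N))) :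
    w ≠ [] := by
  rintro rfl
  exact not_isPrimitive_nil h.1

/-- A primitive circular word has a Lyndon rotation. -/
theorem IsPrimitive.exists_isLyndon {c : Cycle (Letter N)} (h : IsPrimitive c) :
    ∃ w : List (Letter N), IsLyndon w ∧ (w : Cycle (Letter N)) = c := by
  induction c using Quotient.inductionOn' with
  | _ w =>
  rw [Cycle.mk''_eq_coe] at h ⊢
  have hw : w ≠ [] := by
    rintro rfl
    exact not_isPrimitive_nil h
  obtain ⟨v, hv, hmax⟩ := Finset.exists_max_image
    (w.cyclicPermutations : Multiset (List (Letter N))).toFinset id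
    ⟨w, by simpa using List.IsRotated.refl w⟩
  simp only [Multiset.mem_toFinset, Multiset.mem_coe, List.mem_cyclicPermutations_iff, id] at hv hmax
  have hc : (v : Cycle (Letter N)) = w := Cycle.coe_eq_coe.2 hv
  have hv0 : v ≠ [] := by
    rintro rfl
    exact hw (List.isRotated_nil_iff'.1 hv).symm
  rw [← hc, isPrimitive_coe_iff hv0] at h
  exact ⟨v, ⟨hv0, fun k h0 hk => lt_of_le_of_ne (hmax _ ((List.IsRotated.symm ⟨k, rfl⟩ : v.rotate k ~r v).trans hv))
    (h k h0 hk)⟩, hc⟩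

theorem IsLyndon.isPrimitive {w : List (Letter N)} (h : IsLyndon w) :
    IsPrimitive (w : Cycle (Letter N)) :=
  (isPrimitive_coe_iff h.1).2 fun k h0 hk => (h.2 k h0 hk).ne

theorem IsLyndon.eq_of_coe_eq {v w : List (Letter N)} (hv : IsLyndon v) (hw : IsLyndon w)
    (h : (v : Cycle (Letter N)) = w) : v = w := by
  obtain ⟨k, hk, rfl⟩ := List.isRotated_iff_mod.1 (Cycle.coe_eq_coe.1 h)
  rcases Nat.eq_zero_or_pos k with rfl | h0
  · simp
  · rcases hk.lt_or_eq with hk | rfl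
    · exfalso
      have h1 := hv.2 k h0 hk
      have h2 := hw.2 (v.length - k) (by omega) (by simp; omega)
      rw [List.rotate_rotate, Nat.add_sub_cancel' hk.le, List.rotate_length] at h2
      exact absurd h1 h2.not_gt
    · simp

/-! ### Lyndon factors of banners -/

/-- A Lyndon word is the Lyndon rotation of a necklace if and only if it is a banner. -/
theorem IsLyndon.isNecklace_iff {w : List (Letter N)} (h : IsLyndon w) :
    IsNecklace (w : Cycle (Letter N)) ↔ IsBanner w := by
  obtain ⟨a, w, rfl⟩ := List.exists_cons_of_ne_nil h.1
  rw [IsNecklace, and_iff_right h.isPrimitive, Cycle.chain_coe_cons, ← List.cons_append,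
    List.isChain_append]
  constructor
  · rintro ⟨⟨h1, -, h2⟩, h3⟩
    refine ⟨h1, fun b hb => ?_⟩
    -- A barred last letter would equal the head by the wrap-around condition. A longer Lyndon word
    -- does not allow this, and a one-letter word is excluded by condition (3).
    have hf := h2 _ hb a (by simp)
    by_cases hw : w = []
    · subst hw
      simp at hb
      exact h3 b (by rw [hb])
    · rw [List.getLast?_cons, List.getLast?_eq_getLast_of_ne_nil hw] at hb
      simp at hb
      rw [← hb] at hf
      have hle := h.le_head (List.getLast_mem hw)
      exact h.getLast_ne_head hw (Letter.eq_of_barred_le hle (by rw [hb]; rfl) hf)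
  · rintro ⟨h1, h2⟩
    refine ⟨⟨h1, List.isChain_singleton _, fun x hx y hy => ?_⟩, fun b hb => ?_⟩
    · obtain rfl : a = y := by simpa using hy
      refine Letter.follows_of_le ?_ ?_
      · have := List.mem_of_getLast? hx
        rcases List.mem_cons.1 this with rfl | hx
        · exact le_rfl
        · exact h.le_head hx
      · cases x with
        | barred b => exact absurd hx (h2 b)
        | unbarred b m => rfl
    · rw [Cycle.coe_eq_coe, List.isRotated_singleton_iff] at hb
      rw [hb] at h2
      exact h2 b rfl

/-- The last letter of a factor is unbarred and at most the head of its factor, hence at most the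
head of the next one, so every junction is admissible. -/
theorem isBanner_flatten {L : List (List (Letter N))} (hL : ∀ l ∈ L, IsLyndon l)
    (hs : L.Pairwise LexLE) (hB : ∀ l ∈ L, IsBanner l) : IsBanner L.flatten := by
  induction L with
  | nil => exact ⟨List.isChain_nil, by simp⟩
  | cons l L ih =>
    rw [List.pairwise_cons] at hs
    have ih := ih (fun l hl => hL l (by simp [hl])) hs.2 (fun l hl => hB l (by simp [hl]))
    have hl := hB l (by simp)
    rw [List.flatten_cons]
    refine ⟨List.isChain_append.2 ⟨hl.1, ih.1, fun x hx y hy => ?_⟩, fun b hb => ?_⟩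
    · have hlL := hL l (by simp)
      cases L with
      | nil => simp at hy
      | cons l' L =>
        have hlL' := hL l' (by simp)
        obtain ⟨c, l', rfl⟩ := List.exists_cons_of_ne_nil hlL'.1
        obtain ⟨a, l, rfl⟩ := List.exists_cons_of_ne_nil hlL.1
        obtain rfl : c = y := by simpa using hy
        have hac : a ≤ c := (hs.1 (c :: l') (by simp)).head_le
        refine Letter.follows_of_le (le_trans ?_ hac) ?_
        · rcases List.mem_cons.1 (List.mem_of_getLast? hx) with rfl | hx
          · exact le_rfl
          · exact hlL.le_head hx
        · cases x with
          | barred b => exact absurd hx (hl.2 b)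
          | unbarred b m => rfl
    · rw [List.getLast?_append, Option.or_eq_some_iff] at hb
      rcases hb with hb | ⟨-, hb⟩
      · exact ih.2 b hb
      · exact hl.2 b hb

/-- Argue from the right. If a factor ends in a barred letter, the junction forces this letter to be
its own head and the next head. The factor is then that single letter, and so is the next factor,
against the induction hypothesis. -/
theorem isBanner_of_mem_factorization {L : List (List (Letter N))} (hL : ∀ l ∈ L, IsLyndon l)
    (hs : L.Pairwise LexLE) (hB : IsBanner L.flatten) : ∀ l ∈ L, IsBanner l := by
  induction L with
  | nil => simp
  | cons l L ih =>
    rw [List.pairwise_cons] at hs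
    rw [List.flatten_cons] at hB
    obtain ⟨h1, h2, h3⟩ := List.isChain_append.1 hB.1
    have hLf : ∀ b : ℕ+, L.flatten.getLast? ≠ some (Letter.barred b) := by
      intro b hb
      refine hB.2 b ?_
      rw [List.getLast?_append, hb]
      rfl
    have ih := ih (fun l hl => hL l (by simp [hl])) hs.2 ⟨h2, hLf⟩
    intro l' hl'
    rcases List.mem_cons.1 hl' with rfl | hl'
    · refine ⟨h1, fun b hb => ?_⟩
      have hlL := hL l' (by simp)
      cases L with
      | nil =>
        refine hB.2 b ?_
        simpa using hb
      | cons m L =>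
        obtain ⟨c, m, rfl⟩ := List.exists_cons_of_ne_nil (hL m (by simp)).1
        obtain ⟨a, l, rfl⟩ := List.exists_cons_of_ne_nil hlL.1
        have hle := hs.1 (c :: m) (by simp)
        have hac : a ≤ c := hle.head_le
        have hf := h3 _ hb c (by simp)
        have hba : Letter.barred b ≤ a := by
          rcases List.mem_cons.1 (List.mem_of_getLast? hb) with hx | hx
          · exact hx.le
          · exact hlL.le_head hx
        have hbc := Letter.eq_of_barred_le (hba.trans hac) rfl hf
        have hab : a = Letter.barred b := le_antisymm (hac.trans hbc.ge) hba
        have hl : l = [] := by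
          by_contra hl
          rw [List.getLast?_cons, List.getLast?_eq_getLast_of_ne_nil hl] at hb
          simp at hb
          exact hlL.getLast_ne_head hl (hb.trans hab.symm)
        subst hl
        subst hab
        subst hbc
        -- A proper prefix counts as larger, so the one-letter factor cannot precede a longer word
        -- with the same head.
        have hm : m = [] := by
          rcases hle with h | h
          · exact (List.cons.inj h).2.symm
          · cases h with
            | rel h => exact absurd h (lt_irrefl _)
            | cons h => cases h
        subst hm
        exact (ih [Letter.barred b] (by simp)).2 b rfl
    · exact ih l' hl'

/-! ### Ornaments and banners -/

theorem wt_add (s t : Multiset (Letter N)) : wt (s + t) = wt s * wt t := by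
  simp [wt]

theorem bars_add (s t : Multiset (Letter N)) : bars (s + t) = bars s + bars t := by
  simp [bars]

theorem wt_bind {ι : Type*} (S : Multiset ι) (f : ι → Multiset (Letter N)) :
    wt (S.bind f) = (S.map fun i => wt (f i)).prod := by
  induction S using Multiset.induction_on with
  | empty => simp [wt]
  | cons a S ih => rw [Multiset.cons_bind, wt_add, ih, Multiset.map_cons, Multiset.prod_cons]

theorem bars_bind {ι : Type*} (S : Multiset ι) (f : ι → Multiset (Letter N)) :
    bars (S.bind f) = (S.map fun i => bars (f i)).sum := by
  induction S using Multiset.induction_on with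
  | empty => simp [bars]
  | cons a S ih => rw [Multiset.cons_bind, bars_add, ih, Multiset.map_cons, Multiset.sum_cons]

theorem Ornament.weight_eq (R : Ornament N) :
    R.weight = ((R.map Subtype.val).map fun c => wt c.toMultiset).prod := by
  rw [Multiset.map_map]; rfl

theorem Ornament.numBars_eq (R : Ornament N) :
    R.numBars = ((R.map Subtype.val).map fun c => bars c.toMultiset).sum := by
  rw [Multiset.map_map]; rfl

theorem Ornament.cvCycleType_eq (R : Ornament N) :
    R.cvCycleType = (R.map Subtype.val).map fun c => lengthCol c.toMultiset := by
  rw [Multiset.map_map]; rfl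

theorem wt_flatten (L : List (List (Letter N))) :
    wt (L.flatten : Multiset (Letter N)) =
      (L.map fun l : List (Letter N) => wt (l : Multiset (Letter N))).prod := by
  induction L with
  | nil => simp [wt]
  | cons l L ih => rw [List.flatten_cons, ← Multiset.coe_add, wt_add, ih]; simp

theorem bars_flatten (L : List (List (Letter N))) :
    bars (L.flatten : Multiset (Letter N)) =
      (L.map fun l : List (Letter N) => bars (l : Multiset (Letter N))).sum := by
  induction L with
  | nil => simp [bars]
  | cons l L ih => rw [List.flatten_cons, ← Multiset.coe_add, bars_add, ih]; simp

theorem hasCvCycleType_def (B : List (Letter N)) (lam : Multiset (ℕ × (Fin (N - 1) → ℕ))) :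
    HasCvCycleType B lam ↔ ∃ L : List (List (Letter N)), IsLyndonFactorization L B ∧
      (L.map fun l : List (Letter N) => lengthCol (l : Multiset (Letter N)) : List _) = lam := by
  simp [HasCvCycleType, ← List.map_eq_flatMap, Function.comp_def]

/-- The relation between a banner and the ornament formed by its Lyndon factors. -/
def Corresponds (R : Ornament N) (B : List (Letter N)) : Prop :=
  ∃ L : List (List (Letter N)), IsLyndonFactorization L B ∧
    R.map Subtype.val = (L.map ((↑) : List (Letter N) → Cycle (Letter N)) : List _)

theorem Corresponds.weight {R : Ornament N} {B : List (Letter N)} (h : Corresponds R B) :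
    R.weight = wt (B : Multiset (Letter N)) := by
  obtain ⟨L, hL, h⟩ := h
  rw [Ornament.weight_eq, h, ← hL.2.2, wt_flatten, Multiset.map_coe, Multiset.prod_coe, List.map_map]
  rfl

theorem Corresponds.numBars {R : Ornament N} {B : List (Letter N)} (h : Corresponds R B) :
    R.numBars = bars (B : Multiset (Letter N)) := by
  obtain ⟨L, hL, h⟩ := h
  rw [Ornament.numBars_eq, h, ← hL.2.2, bars_flatten, Multiset.map_coe, Multiset.sum_coe, List.map_map]
  rfl

theorem Corresponds.hasCvCycleType_iff {R : Ornament N} {B : List (Letter N)}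
    (h : Corresponds R B) (lam : Multiset (ℕ × (Fin (N - 1) → ℕ))) :
    HasCvCycleType B lam ↔ R.cvCycleType = lam := by
  obtain ⟨L, hL, h⟩ := h
  rw [Ornament.cvCycleType_eq, h, Multiset.map_coe, List.map_map, hasCvCycleType_def]
  constructor
  · rintro ⟨M, hM, rfl⟩
    rw [hM.unique hL]
    rfl
  · rintro rfl
    exact ⟨L, hL, rfl⟩

/-- Replace each necklace by its Lyndon rotation, sort, and concatenate. -/
theorem exists_corresponds_of_ornament (R : Ornament N) :
    ∃ B, IsBanner B ∧ Corresponds R B := by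
  classical
  choose g hg using fun c : Necklace N => c.2.1.exists_isLyndon
  let L := ((R.map g).toList).insertionSort LexLE
  have hmem : ∀ l ∈ L, ∃ c ∈ R, g c = l := by
    intro l hl
    simpa [L] using hl
  have hLyn : ∀ l ∈ L, IsLyndon l := by
    intro l hl
    obtain ⟨c, -, rfl⟩ := hmem l hl
    exact (hg c).1
  have hs : L.Pairwise LexLE := List.pairwise_insertionSort LexLE _
  refine ⟨L.flatten, isBanner_flatten hLyn hs ?_, L, ⟨hLyn, hs, rfl⟩, ?_⟩
  · intro l hl
    rw [← (hLyn l hl).isNecklace_iff]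
    obtain ⟨c, -, rfl⟩ := hmem l hl
    rw [(hg c).2]
    exact c.2
  · have hL : (L : Multiset (List (Letter N))) = R.map g := by
      rw [← Multiset.coe_toList (R.map g)]
      exact Multiset.coe_eq_coe.2 (List.perm_insertionSort _ _)
    rw [← Multiset.map_coe, hL, Multiset.map_map]
    exact Multiset.map_congr rfl fun c _ => ((hg c).2).symm

theorem exists_corresponds_of_banner {B : List (Letter N)} (hB : IsBanner B)
    {lam : Multiset (ℕ × (Fin (N - 1) → ℕ))} (h : HasCvCycleType B lam) :
    ∃ R : Ornament N, Corresponds R B := by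
  obtain ⟨L, hL, -⟩ := (hasCvCycleType_def B lam).1 h
  have hn : ∀ l ∈ L, IsNecklace (l : Cycle (Letter N)) := fun l hl =>
    (hL.1 l hl).isNecklace_iff.2
      (isBanner_of_mem_factorization hL.1 hL.2.1 (hL.2.2.symm ▸ hB) l hl)
  refine ⟨(L.attach.map fun l => ⟨l.1, hn l.1 l.2⟩ : List (Necklace N)), L, hL, ?_⟩
  rw [Multiset.map_coe, List.map_map]
  congr 1
  exact List.attach_map_val (f := ((↑) : List (Letter N) → Cycle (Letter N)))

theorem Corresponds.ornament_unique {R S : Ornament N} {B : List (Letter N)}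
    (hR : Corresponds R B) (hS : Corresponds S B) : R = S := by
  obtain ⟨L, hL, h1⟩ := hR
  obtain ⟨M, hM, h2⟩ := hS
  rw [hM.unique hL, ← h1] at h2
  exact Multiset.map_injective Subtype.val_injective h2.symm

theorem Corresponds.banner_unique {R : Ornament N} {B C : List (Letter N)}
    (hB : Corresponds R B) (hC : Corresponds R C) : B = C := by
  obtain ⟨L, hL, h1⟩ := hB
  obtain ⟨M, hM, h2⟩ := hC
  have hperm := Multiset.coe_eq_coe.1 (h1.symm.trans h2)
  have hLM : L.Perm M := by
    rw [← Multiset.coe_eq_coe]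
    rw [← Multiset.coe_eq_coe, ← Multiset.map_coe, ← Multiset.map_coe] at hperm
    -- Taking circular words is injective on Lyndon words, so its inverse there recovers the
    -- multiset of factors.
    have hpmap : ∀ (K : List (List (Letter N))) (hK : ∀ l ∈ K, IsLyndon l),
        (K : Multiset (List (Letter N))) =
          ((K : Multiset (List (Letter N))).map ((↑) : List (Letter N) → Cycle (Letter N))).map
            (Function.invFunOn (↑) {l | IsLyndon l}) := by
      intro K hK
      rw [Multiset.map_map]
      conv_lhs => rw [← Multiset.map_id (K : Multiset (List (Letter N)))]
      refine Multiset.map_congr rfl fun l hl => ?_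
      have hex : ∃ v ∈ {l : List (Letter N) | IsLyndon l}, (v : Cycle (Letter N)) = l :=
        ⟨l, hK l hl, rfl⟩
      exact (IsLyndon.eq_of_coe_eq (Function.invFunOn_mem hex) (hK l hl)
        (Function.invFunOn_eq hex)).symm
    rw [hpmap L hL.1, hpmap M hM.1, hperm]
  rw [← hL.2.2, ← hM.2.2, hLM.eq_of_pairwise' hL.2.1 hM.2.1]

/-- Ornaments and banners correspond bijectively, by the weight preserving map that takes an
ornament to the banner with the same Lyndon factors. -/
theorem exists_ornaments_equiv_banners (lam : Multiset (ℕ × (Fin (N - 1) → ℕ))) (j : ℕ) :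
    ∃ e : ornaments lam j ≃ banners lam j, ∀ R : ornaments lam j,
      wt ((e R).1 : Multiset (Letter N)) = Ornament.weight R.1 := by
  choose b hb using fun R : Ornament N => exists_corresponds_of_ornament R
  let f : ornaments lam j → banners lam j := fun R =>
    ⟨b R.1, (hb R.1).1, ((hb R.1).2.hasCvCycleType_iff lam).2 R.2.1,
      (hb R.1).2.numBars.symm.trans R.2.2⟩
  have hf : Function.Bijective f := by
    constructor
    · intro R S h
      have h' : b R.1 = b S.1 := congrArg Subtype.val h
      exact Subtype.ext ((hb R.1).2.ornament_unique (h' ▸ (hb S.1).2))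
    · rintro ⟨B, hB, hlam, hj⟩
      obtain ⟨R, hR⟩ := exists_corresponds_of_banner hB hlam
      exact ⟨⟨R, (hR.hasCvCycleType_iff lam).1 hlam, hR.numBars.trans hj⟩,
        Subtype.ext ((hb R).2.banner_unique hR)⟩
  exact ⟨Equiv.ofBijective f hf, fun R => (hb R.1).2.weight.symm⟩

end ColoredEulerian

end

noncomputable section

namespace ColoredEulerian

open ColoredPerm (cycleSets)

/-! ### The circular words of a permutation with labelled points -/

section Cycles

variable {n : ℕ} {Λ : Type*}

/-- The circular word read off the cycle of `σ` through `a`. -/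
def cycleWord (σ : Equiv.Perm (Fin n)) (ℓ : Fin n → Λ) (a : Fin n) : Cycle Λ :=
  (Function.periodicOrbit σ a).map ℓ

/-- The infinite word of the labels of `a, σ a, σ (σ a), …`. -/
def orbitWord (σ : Equiv.Perm (Fin n)) (ℓ : Fin n → Λ) (a : Fin n) (m : ℕ) : Λ := ℓ (σ^[m] a)

/-- The multiset of the circular words of all the cycles of `σ`. -/
def cycleWords (σ : Equiv.Perm (Fin n)) (ℓ : Fin n → Λ) : Multiset (Cycle Λ) :=
  (cycleSets σ).val.map fun c => if h : c.Nonempty then cycleWord σ ℓ (c.min' h) else Cycle.nil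

theorem mem_periodicPts (σ : Equiv.Perm (Fin n)) (a : Fin n) : a ∈ Function.periodicPts σ :=
  σ.injective.mem_periodicPts a

theorem sameCycle_iff_iterate {σ : Equiv.Perm (Fin n)} {a b : Fin n} :
    σ.SameCycle a b ↔ ∃ m : ℕ, σ^[m] a = b := by
  constructor
  · intro h
    obtain ⟨m, hm⟩ := h.exists_nat_pow_eq
    exact ⟨m, by rw [Equiv.Perm.iterate_eq_pow, hm]⟩
  · rintro ⟨m, rfl⟩
    exact ⟨m, by rw [Equiv.Perm.iterate_eq_pow]; simp⟩

theorem toMultiset_periodicOrbit (σ : Equiv.Perm (Fin n)) (a : Fin n) :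
    (Function.periodicOrbit σ a).toMultiset = (Finset.univ.filter fun k => σ.SameCycle a k).val := by
  have hnd : (Function.periodicOrbit σ a).toMultiset.Nodup := by
    have := Function.nodup_periodicOrbit (f := σ) (x := a)
    rw [Function.periodicOrbit_def] at this ⊢
    exact this
  refine (Multiset.Nodup.ext hnd (Finset.nodup _)).2 fun b => ?_
  have : b ∈ (Function.periodicOrbit σ a).toMultiset ↔ b ∈ Function.periodicOrbit σ a := by
    rw [Function.periodicOrbit_def]
    rfl
  rw [this, Function.mem_periodicOrbit_iff (mem_periodicPts σ a), Finset.mem_val,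
    Finset.mem_filter, sameCycle_iff_iterate]
  simp

theorem cycleWord_eq_of_sameCycle {σ : Equiv.Perm (Fin n)} {a b : Fin n} (ℓ : Fin n → Λ)
    (h : σ.SameCycle a b) : cycleWord σ ℓ a = cycleWord σ ℓ b := by
  obtain ⟨m, rfl⟩ := sameCycle_iff_iterate.1 h
  rw [cycleWord, cycleWord, Function.periodicOrbit_apply_iterate_eq (mem_periodicPts σ a)]

theorem toMultiset_map (c : Cycle (Fin n)) (ℓ : Fin n → Λ) :
    (c.map ℓ).toMultiset = c.toMultiset.map ℓ := by
  induction c using Quotient.inductionOn'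
  rfl

theorem toMultiset_cycleWord (σ : Equiv.Perm (Fin n)) (ℓ : Fin n → Λ) (a : Fin n) :
    (cycleWord σ ℓ a).toMultiset = (Finset.univ.filter fun k => σ.SameCycle a k).val.map ℓ := by
  rw [cycleWord, toMultiset_map, toMultiset_periodicOrbit]

theorem mem_cycleSets {σ : Equiv.Perm (Fin n)} {c : Finset (Fin n)} :
    c ∈ cycleSets σ ↔ ∃ a, (Finset.univ.filter fun k => σ.SameCycle a k) = c := by
  simp [cycleSets]

theorem self_mem_filter_sameCycle (σ : Equiv.Perm (Fin n)) (a : Fin n) :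
    a ∈ Finset.univ.filter fun k => σ.SameCycle a k :=
  Finset.mem_filter.2 ⟨Finset.mem_univ a, Equiv.Perm.SameCycle.refl σ a⟩

theorem filter_sameCycle_eq {σ : Equiv.Perm (Fin n)} {a b : Fin n} (h : σ.SameCycle a b) :
    (Finset.univ.filter fun k => σ.SameCycle a k) =
      Finset.univ.filter fun k => σ.SameCycle b k := by
  ext k
  simp only [Finset.mem_filter, Finset.mem_univ, true_and]
  exact ⟨fun hk => h.symm.trans hk, fun hk => h.trans hk⟩

/-- Cycle sets are nonempty, so the default `Cycle.nil` in `cycleWords` never occurs, and the least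
point represents its cycle. -/
theorem cycleSet_min {σ : Equiv.Perm (Fin n)} {c : Finset (Fin n)} (hc : c ∈ cycleSets σ) :
    ∃ h : c.Nonempty, (Finset.univ.filter fun k => σ.SameCycle (c.min' h) k) = c := by
  obtain ⟨a, ha⟩ := mem_cycleSets.1 hc
  have hne : c.Nonempty := ⟨a, ha ▸ self_mem_filter_sameCycle σ a⟩
  refine ⟨hne, ?_⟩
  have hmem := c.min'_mem hne
  generalize c.min' hne = b at hmem
  rw [← ha, Finset.mem_filter] at hmem
  rw [← filter_sameCycle_eq hmem.2, ha]

/-- The circular word does not depend on the chosen point of the cycle, so any system of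
representatives serves. -/
theorem cycleWords_eq_of_transversal {ι : Type*} [Fintype ι] {σ : Equiv.Perm (Fin n)}
    (ℓ : Fin n → Λ) (r : ι → Fin n) (hr : ∀ a, ∃! t, σ.SameCycle (r t) a) :
    cycleWords σ ℓ = (Finset.univ : Finset ι).val.map fun t => cycleWord σ ℓ (r t) := by
  let f : ι ↪ Finset (Fin n) := ⟨fun t => Finset.univ.filter fun k => σ.SameCycle (r t) k, by
    intro s t h
    have hmem : r s ∈ Finset.univ.filter fun k => σ.SameCycle (r t) k := by
      have h' : (Finset.univ.filter fun k => σ.SameCycle (r s) k) =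
        Finset.univ.filter fun k => σ.SameCycle (r t) k := h
      exact h' ▸ self_mem_filter_sameCycle σ (r s)
    exact (hr (r s)).unique (Equiv.Perm.SameCycle.refl _ _) (Finset.mem_filter.1 hmem).2⟩
  have hsets : cycleSets σ = Finset.univ.map f := by
    ext c
    rw [mem_cycleSets, Finset.mem_map]
    constructor
    · rintro ⟨a, rfl⟩
      obtain ⟨t, ht, -⟩ := hr a
      exact ⟨t, Finset.mem_univ _, filter_sameCycle_eq ht⟩
    · rintro ⟨t, -, rfl⟩
      exact ⟨r t, rfl⟩
  rw [cycleWords, hsets, Finset.map_val, Multiset.map_map]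
  refine Multiset.map_congr rfl fun t _ => ?_
  have hne : (f t).Nonempty := ⟨r t, self_mem_filter_sameCycle σ (r t)⟩
  have hmem := (f t).min'_mem hne
  rw [Function.comp_apply, dif_pos hne]
  exact (cycleWord_eq_of_sameCycle ℓ (Finset.mem_filter.1 hmem).2).symm

theorem mem_cycleWords {σ : Equiv.Perm (Fin n)} {ℓ : Fin n → Λ} {w : Cycle Λ} :
    w ∈ cycleWords σ ℓ ↔ ∃ a, cycleWord σ ℓ a = w := by
  rw [cycleWords, Multiset.mem_map]
  constructor
  · rintro ⟨c, hc, rfl⟩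
    obtain ⟨hne, -⟩ := cycleSet_min hc
    exact ⟨c.min' hne, by rw [dif_pos hne]⟩
  · rintro ⟨a, rfl⟩
    refine ⟨Finset.univ.filter fun k => σ.SameCycle a k, mem_cycleSets.2 ⟨a, rfl⟩, ?_⟩
    have hne : (Finset.univ.filter fun k => σ.SameCycle a k).Nonempty :=
      ⟨a, self_mem_filter_sameCycle σ a⟩
    rw [dif_pos hne]
    have hmem := Finset.min'_mem _ hne
    exact (cycleWord_eq_of_sameCycle ℓ (Finset.mem_filter.1 hmem).2).symm

theorem map_toMultiset_cycleWords (σ : Equiv.Perm (Fin n)) (ℓ : Fin n → Λ) :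
    (cycleWords σ ℓ).map Cycle.toMultiset = (cycleSets σ).val.map fun c => c.val.map ℓ := by
  rw [cycleWords, Multiset.map_map]
  refine Multiset.map_congr rfl fun c hc => ?_
  obtain ⟨hne, h⟩ := cycleSet_min hc
  rw [Function.comp_apply, dif_pos hne, toMultiset_cycleWord, h]

theorem univ_val_eq_bind_cycleSets (σ : Equiv.Perm (Fin n)) :
    (Finset.univ : Finset (Fin n)).val = (cycleSets σ).val.bind Finset.val := by
  have hd : ((cycleSets σ : Finset (Finset (Fin n))) : Set (Finset (Fin n))).PairwiseDisjoint
      (fun c => c) := by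
    intro c hc d hd hne
    obtain ⟨a, rfl⟩ := mem_cycleSets.1 hc
    obtain ⟨b, rfl⟩ := mem_cycleSets.1 hd
    refine Finset.disjoint_left.2 fun k hk hk' => hne (filter_sameCycle_eq ?_)
    exact (Finset.mem_filter.1 hk).2.trans (Finset.mem_filter.1 hk').2.symm
  have : (Finset.univ : Finset (Fin n)) = (cycleSets σ).disjiUnion (fun c => c) hd := by
    ext a
    simp only [Finset.mem_univ, Finset.mem_disjiUnion, true_iff]
    exact ⟨_, mem_cycleSets.2 ⟨a, rfl⟩, self_mem_filter_sameCycle σ a⟩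
  rw [this]
  rfl

/-- The cycles partition the points. Weight and number of bars can therefore be counted over
positions. -/
theorem univ_map_eq_bind_cycleWords (σ : Equiv.Perm (Fin n)) (ℓ : Fin n → Λ) :
    (Finset.univ : Finset (Fin n)).val.map ℓ = (cycleWords σ ℓ).bind Cycle.toMultiset := by
  rw [univ_val_eq_bind_cycleSets σ, Multiset.map_bind, Multiset.bind, Multiset.bind,
    map_toMultiset_cycleWords]

/-- The periodic infinite word with period `l`. -/
def periodicWord (l : List Λ) (m : ℕ) : Option Λ := l[m % l.length]?

/-- The periodic infinite words of a circular word. -/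
def periodicWords (c : Cycle Λ) : Multiset (ℕ → Option Λ) := c.lists.map periodicWord

/-- The labels of the points of the cycle of `σ` through `a`, starting at `a`. -/
def cycleList (σ : Equiv.Perm (Fin n)) (ℓ : Fin n → Λ) (a : Fin n) : List Λ :=
  (List.range (Function.minimalPeriod σ a)).map (orbitWord σ ℓ a)

theorem coe_cycleList (σ : Equiv.Perm (Fin n)) (ℓ : Fin n → Λ) (a : Fin n) :
    (cycleList σ ℓ a : Cycle Λ) = cycleWord σ ℓ a := by
  rw [cycleWord, Function.periodicOrbit_def, Cycle.map_coe, List.map_map]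
  rfl

theorem length_cycleList (σ : Equiv.Perm (Fin n)) (ℓ : Fin n → Λ) (a : Fin n) :
    (cycleList σ ℓ a).length = Function.minimalPeriod σ a := by
  simp [cycleList]

theorem minimalPeriod_pos (σ : Equiv.Perm (Fin n)) (a : Fin n) :
    0 < Function.minimalPeriod σ a :=
  Function.minimalPeriod_pos_of_mem_periodicPts (mem_periodicPts σ a)

theorem cycleList_ne_nil (σ : Equiv.Perm (Fin n)) (ℓ : Fin n → Λ) (a : Fin n) :
    cycleList σ ℓ a ≠ [] :=
  List.ne_nil_of_length_pos ((length_cycleList σ ℓ a).symm ▸ minimalPeriod_pos σ a)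

theorem periodicWord_rotate_cycleList (σ : Equiv.Perm (Fin n)) (ℓ : Fin n → Λ) (a : Fin n)
    (k : ℕ) : periodicWord ((cycleList σ ℓ a).rotate k) =
      fun m => some (orbitWord σ ℓ (σ^[k] a) m) := by
  have hp0 := minimalPeriod_pos σ a
  funext m
  rw [periodicWord, List.length_rotate, List.getElem?_rotate
    (by rw [length_cycleList]; exact Nat.mod_lt _ hp0), length_cycleList]
  simp only [cycleList, List.getElem?_map, orbitWord]
  rw [List.getElem?_range (Nat.mod_lt _ hp0)]
  simp only [Option.map_some, Nat.mod_add_mod, ← Function.iterate_add_apply, orbitWord]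
  rw [Function.iterate_mod_minimalPeriod_eq]

theorem periodicWords_cycleWord (σ : Equiv.Perm (Fin n)) (ℓ : Fin n → Λ) (a : Fin n) :
    periodicWords (cycleWord σ ℓ a) =
      (Finset.univ.filter fun k => σ.SameCycle a k).val.map
        fun b m => some (orbitWord σ ℓ b m) := by
  rw [← toMultiset_periodicOrbit, ← coe_cycleList, Function.periodicOrbit_def,
    periodicWords, Cycle.lists_coe, Cycle.coe_toMultiset, Multiset.map_coe, Multiset.map_coe]
  congr 1
  apply List.ext_getElem
  · rw [List.length_map, List.length_cyclicPermutations_of_ne_nil _ (cycleList_ne_nil σ ℓ a),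
      length_cycleList]
    simp
  · intro k hk _
    simp only [List.getElem_map, List.getElem_cyclicPermutations, List.getElem_range]
    exact periodicWord_rotate_cycleList σ ℓ a k

/-- The infinite words read from the points of a cycle are the periodic extensions of the rotations
of its circular word, with multiplicity. -/
theorem map_orbitWord_eq_of_cycleWords_eq {σ τ : Equiv.Perm (Fin n)} {ℓ ℓ' : Fin n → Λ}
    (h : cycleWords σ ℓ = cycleWords τ ℓ') :
    (Finset.univ : Finset (Fin n)).val.map (orbitWord σ ℓ) =
      (Finset.univ : Finset (Fin n)).val.map (orbitWord τ ℓ') := by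
  have key : ∀ (σ : Equiv.Perm (Fin n)) (ℓ : Fin n → Λ),
      ((Finset.univ : Finset (Fin n)).val.map fun b m => some (orbitWord σ ℓ b m)) =
        (cycleWords σ ℓ).bind periodicWords := by
    intro σ ℓ
    rw [univ_val_eq_bind_cycleSets σ, Multiset.map_bind, cycleWords, Multiset.bind_map]
    refine Multiset.bind_congr fun c hc => ?_
    obtain ⟨hne, hc⟩ := cycleSet_min hc
    rw [dif_pos hne, periodicWords_cycleWord, hc]
  have hinj : Function.Injective fun (f : ℕ → Λ) (m : ℕ) => some (f m) :=
    fun f g hfg => funext fun m => Option.some_injective _ (congrFun hfg m)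
  apply Multiset.map_injective hinj
  rw [Multiset.map_map, Multiset.map_map]
  exact (key σ ℓ).trans ((congrArg (Multiset.bind · periodicWords) h).trans (key τ ℓ').symm)

theorem orbitWord_apply (σ : Equiv.Perm (Fin n)) (ℓ : Fin n → Λ) (a : Fin n) (m : ℕ) :
    orbitWord σ ℓ (σ a) m = orbitWord σ ℓ a (m + 1) := rfl

/-- The words are purely periodic: the first label, lost on passing to `σ a`, returns after `orderOf
σ - 1` further steps. -/
theorem orbitWord_eq_of_apply_eq {σ : Equiv.Perm (Fin n)} {ℓ : Fin n → Λ} {a b : Fin n}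
    (h : orbitWord σ ℓ (σ a) = orbitWord σ ℓ (σ b)) : orbitWord σ ℓ a = orbitWord σ ℓ b := by
  funext m
  cases m with
  | succ m => exact congrFun h m
  | zero =>
    have hpos : 0 < orderOf σ := orderOf_pos σ
    have hper : ∀ c, orbitWord σ ℓ c 0 = orbitWord σ ℓ (σ c) (orderOf σ - 1) := by
      intro c
      rw [orbitWord_apply, Nat.sub_add_cancel hpos, orbitWord, orbitWord,
        Equiv.Perm.iterate_eq_pow σ (orderOf σ), pow_orderOf_eq_one]
      rfl
    rw [hper, hper, h]

end Cycles

end ColoredEulerian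

end

noncomputable section

namespace ColoredEulerian

variable {N n : ℕ}

/-! ### Standard labelled permutations -/

/-- Sort key for the order of the letters along the positions of a standard labelled permutation:
letters of larger absolute value come first; among the letters of a given absolute value the barred
one comes first, then the unbarred ones by decreasing color. -/
def Letter.rank (x : Letter N) : ℤ ×ₗ ℤ :=
  toLex (-((x.abs : ℕ) : ℤ), if x.isBarred then -(N : ℤ) else -(x.color : ℤ))

/-- This places the second coordinate `-N` of a barred letter's rank strictly below every `-color`
of an unbarred one. -/
theorem Letter.color_lt {x : Letter N} (h : x.isBarred = false) : x.color < N := by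
  cases x with
  | unbarred a m => exact m.2
  | barred a => simp [isBarred] at h

theorem Letter.rank_injective : Function.Injective (Letter.rank : Letter N → ℤ ×ₗ ℤ) := by
  intro x y h
  simp only [rank, EmbeddingLike.apply_eq_iff_eq, Prod.mk.injEq, neg_inj, Nat.cast_inj] at h
  obtain ⟨h1, h2⟩ := h
  have h1 := PNat.coe_injective h1
  cases hx : x.isBarred <;> cases hy : y.isBarred <;>
    simp only [hx, hy, if_true, Bool.false_eq_true, if_false, neg_inj, Nat.cast_inj] at h2
  · exact ext_of h1 h2 (hx.trans hy.symm)
  · exact absurd h2 (color_lt hx).ne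
  · exact absurd h2.symm (color_lt hy).ne
  · exact ext_of h1 (by rw [color_of_isBarred hx, color_of_isBarred hy]) (hx.trans hy.symm)

theorem Letter.rank_lt_iff {x y : Letter N} : x.rank < y.rank ↔ y.abs < x.abs ∨
    x.abs = y.abs ∧ (x.isBarred = true ∧ y.isBarred = false ∨
      x.isBarred = false ∧ y.isBarred = false ∧ y.color < x.color) := by
  rw [rank, rank, Prod.Lex.lt_iff]
  simp only [ofLex_toLex, neg_lt_neg_iff, Nat.cast_lt, neg_inj, Nat.cast_inj, PNat.coe_lt_coe,
    PNat.coe_inj]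
  cases hx : x.isBarred <;> cases hy : y.isBarred <;>
    simp [(color_lt · |>.le), hx, hy, color_lt]

theorem Letter.abs_le_of_rank_le {x y : Letter N} (h : x.rank ≤ y.rank) : y.abs ≤ x.abs := by
  rcases h.lt_or_eq with h | h
  · rcases rank_lt_iff.1 h with h | h
    · exact h.le
    · exact h.1.ge
  · rw [rank_injective h]

/-- A barred letter has least rank for its absolute value, so a change of letter after it raises the
rank; this produces the excedances. -/
theorem Letter.rank_lt_of_follows_barred {x y : Letter N} (h : Follows x y)
    (hx : x.isBarred = true) (hne : x ≠ y) : x.rank < y.rank := by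
  rw [rank_lt_iff]
  rcases (h.1 hx).lt_or_eq with h | h
  · exact Or.inl h
  · refine Or.inr ⟨h.symm, Or.inl ⟨hx, ?_⟩⟩
    by_contra hy
    rw [Bool.not_eq_false] at hy
    exact hne (ext_of h.symm (by rw [color_of_isBarred hx, color_of_isBarred hy])
      (hx.trans hy.symm))

/-- Dually, an unbarred `0`-colored letter has greatest rank for its absolute value. -/
theorem Letter.rank_lt_of_follows_unbarred {x y : Letter N} (h : Follows x y)
    (hx : x.isBarred = false) (hc : x.color = 0) (hne : x ≠ y) : y.rank < x.rank := by
  rw [rank_lt_iff]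
  rcases (h.2 ⟨hc, hx⟩).lt_or_eq with h | h
  · exact Or.inl h
  · refine Or.inr ⟨h.symm, ?_⟩
    cases hy : y.isBarred
    · refine Or.inr ⟨rfl, hx, ?_⟩
      rw [hc, Nat.pos_iff_ne_zero]
      exact fun hy' => hne (ext_of h (hc.trans hy'.symm) (hx.trans hy.symm))
    · exact Or.inl ⟨rfl, hx⟩

/-- A permutation of the positions whose points are labelled by letters is standard if the positions
are ordered lexicographically by the infinite words of their labels, consistently along the
cycles, and exactly the `0`-colored excedances are barred. -/
structure IsStandard (σ : Equiv.Perm (Fin n)) (ℓ : Fin n → Letter N) : Prop where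
  rank_le : ∀ a b, a < b → (ℓ a).rank ≤ (ℓ b).rank
  apply_lt : ∀ a b, a < b → ℓ a = ℓ b → σ a < σ b
  isBarred_iff : ∀ a, (ℓ a).isBarred = true ↔ (ℓ a).color = 0 ∧ a < σ a

/-- The infinite word of ranks of the labels along the orbit of `a`. -/
def rankWord (σ : Equiv.Perm (Fin n)) (ℓ : Fin n → Letter N) (a : Fin n) : Lex (ℕ → ℤ ×ₗ ℤ) :=
  toLex fun m => (orbitWord σ ℓ a m).rank

theorem rankWord_eq_iff {σ τ : Equiv.Perm (Fin n)} {ℓ ℓ' : Fin n → Letter N} {a b : Fin n} :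
    rankWord σ ℓ a = rankWord τ ℓ' b ↔ orbitWord σ ℓ a = orbitWord τ ℓ' b := by
  constructor
  · intro h
    exact funext fun m => Letter.rank_injective (congrFun (toLex.injective h) m)
  · intro h
    rw [rankWord, rankWord, h]

theorem rankWord_lt_iff {σ : Equiv.Perm (Fin n)} {ℓ : Fin n → Letter N} {a b : Fin n} :
    rankWord σ ℓ a < rankWord σ ℓ b ↔ ∃ i, (∀ j < i, ℓ (σ^[j] a) = ℓ (σ^[j] b)) ∧
      (ℓ (σ^[i] a)).rank < (ℓ (σ^[i] b)).rank := by
  constructor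
  · rintro ⟨i, h1, h2⟩
    exact ⟨i, fun j hj => Letter.rank_injective (h1 j hj), h2⟩
  · rintro ⟨i, h1, h2⟩
    exact ⟨i, fun j hj => congrArg Letter.rank (h1 j hj), h2⟩

namespace IsStandard

variable {σ τ : Equiv.Perm (Fin n)} {ℓ ℓ' : Fin n → Letter N}

theorem iterate_lt (h : IsStandard σ ℓ) {a b : Fin n} (hab : a < b) {m : ℕ}
    (heq : ∀ j < m, ℓ (σ^[j] a) = ℓ (σ^[j] b)) : σ^[m] a < σ^[m] b := by
  induction m with
  | zero => exact hab
  | succ m ih =>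
    rw [Function.iterate_succ_apply', Function.iterate_succ_apply']
    exact h.apply_lt _ _ (ih fun j hj => heq j (by omega)) (heq m (by omega))

/-- While the labels agree, `σ` keeps the order of the two positions; at the first difference
`rank_le` decides. -/
theorem monotone_rankWord (h : IsStandard σ ℓ) : Monotone (rankWord σ ℓ) := by
  refine monotone_iff_forall_lt.2 fun a b hab => not_lt.1 fun hlt => ?_
  obtain ⟨i, h1, h2⟩ := rankWord_lt_iff.1 hlt
  exact absurd h2 (h.rank_le _ _ (h.iterate_lt hab fun j hj => (h1 j hj).symm)).not_gt

/-- The point `k` with `τ k = σ i` has the same infinite word as `i`. If `k < i`, then `σ k = σ i`;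
if `k = i`, then `τ i = σ i`; if `k > i`, standardness of `τ` gives `τ i < σ i`. -/
theorem apply_not_lt (hτ : IsStandard τ ℓ)
    (hw : orbitWord σ ℓ = orbitWord τ ℓ) {i : Fin n} (ih : ∀ k < i, σ k = τ k) :
    ¬ σ i < τ i := by
  intro hlt
  set k := τ.symm (σ i) with hk
  have hτk : τ k = σ i := by simp [hk]
  have hwk : orbitWord τ ℓ k = orbitWord τ ℓ i := by
    apply orbitWord_eq_of_apply_eq
    rw [hτk, ← hw]
    funext m
    rw [orbitWord_apply, hw, orbitWord_apply]
  have hℓ : ℓ k = ℓ i := congrFun hwk 0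
  rcases lt_trichotomy k i with hki | hki | hki
  · have := ih k hki
    rw [hτk] at this
    exact hki.ne (σ.injective this)
  · rw [hki] at hτk
    exact hlt.ne hτk.symm
  · have := hτ.apply_lt _ _ hki hℓ.symm
    rw [hτk] at this
    exact this.not_gt hlt

/-- A standard labelled permutation is determined by the circular words of its cycles. -/
theorem eq_of_cycleWords_eq (hσ : IsStandard σ ℓ) (hτ : IsStandard τ ℓ')
    (h : cycleWords σ ℓ = cycleWords τ ℓ') : σ = τ ∧ ℓ = ℓ' := by
  have h1 := map_orbitWord_eq_of_cycleWords_eq h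
  have h2 : (Finset.univ : Finset (Fin n)).val.map (rankWord σ ℓ) =
      (Finset.univ : Finset (Fin n)).val.map (rankWord τ ℓ') := by
    have := congrArg (Multiset.map fun f : ℕ → Letter N => toLex fun m => (f m).rank) h1
    rwa [Multiset.map_map, Multiset.map_map] at this
  rw [Fin.univ_val_map, Fin.univ_val_map, Multiset.coe_eq_coe] at h2
  -- A weakly increasing sequence is determined by the multiset of its values.
  have h3 : rankWord σ ℓ = rankWord τ ℓ' := List.ofFn_injective
    (h2.eq_of_pairwise' hσ.monotone_rankWord.sortedLE_ofFn.pairwise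
      hτ.monotone_rankWord.sortedLE_ofFn.pairwise)
  have hw : orbitWord σ ℓ = orbitWord τ ℓ' := funext fun a => rankWord_eq_iff.1 (congrFun h3 a)
  have hℓ : ℓ = ℓ' := funext fun a => congrFun (congrFun hw a) 0
  subst hℓ
  refine ⟨Equiv.ext fun i => ?_, rfl⟩
  induction i using WellFoundedLT.induction with
  | ind i ih =>
  exact le_antisymm (not_lt.1 (apply_not_lt hσ hw.symm fun k hk => (ih k hk).symm))
    (not_lt.1 (apply_not_lt hτ hw ih))

theorem follows (h : IsStandard σ ℓ) (a : Fin n) : Letter.Follows (ℓ a) (ℓ (σ a)) := by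
  refine ⟨fun hb => ?_, fun ⟨hc, hb⟩ => ?_⟩
  · exact Letter.abs_le_of_rank_le (h.rank_le _ _ ((h.isBarred_iff a).1 hb).2)
  · have hle : σ a ≤ a := by
      by_contra hlt
      rw [(h.isBarred_iff a).2 ⟨hc, not_le.1 hlt⟩] at hb
      simp at hb
    rcases hle.lt_or_eq with hlt | heq
    · exact Letter.abs_le_of_rank_le (h.rank_le _ _ hlt)
    · rw [heq]

/-- If the words agreed, iterating `σ^[k]` would move `a` strictly in one direction forever,
impossible among finitely many positions. This gives primitivity. -/
theorem orbitWord_iterate_ne (h : IsStandard σ ℓ) {a : Fin n} {k : ℕ} (hk : σ^[k] a ≠ a) :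
    orbitWord σ ℓ (σ^[k] a) ≠ orbitWord σ ℓ a := by
  intro he
  have key : ∀ m, (σ^[k])^[m + 1] a = σ^[k * m] (σ^[k] a) := by
    intro m
    rw [← Function.iterate_mul, ← Function.iterate_add_apply]
    rfl
  rcases hk.lt_or_gt with hlt | hlt
  · have : StrictAnti fun m => (σ^[k])^[m] a := by
      refine strictAnti_nat_of_succ_lt fun m => ?_
      rw [key, ← Function.iterate_mul]
      exact h.iterate_lt hlt fun j _ => congrFun he j
    exact not_injective_infinite_finite _ this.injective
  · have : StrictMono fun m => (σ^[k])^[m] a := by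
      refine strictMono_nat_of_lt_succ fun m => ?_
      rw [key, ← Function.iterate_mul]
      exact h.iterate_lt hlt fun j _ => (congrFun he j).symm
    exact not_injective_infinite_finite _ this.injective

theorem isNecklace_cycleWord (h : IsStandard σ ℓ) (a : Fin n) :
    IsNecklace (cycleWord σ ℓ a) := by
  refine ⟨?_, ?_, fun b hb => ?_⟩
  · rw [← coe_cycleList, isPrimitive_coe_iff (cycleList_ne_nil σ ℓ a)]
    intro k h0 hk he
    rw [length_cycleList] at hk
    refine h.orbitWord_iterate_ne (a := a) (k := k)
      (Function.not_isPeriodicPt_of_pos_of_lt_minimalPeriod h0.ne' hk) ?_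
    have h1 := periodicWord_rotate_cycleList σ ℓ a k
    have h2 := periodicWord_rotate_cycleList σ ℓ a 0
    rw [List.rotate_zero] at h2
    rw [he, h2] at h1
    exact funext fun m => (Option.some_injective _ (congrFun h1 m)).symm
  · rw [cycleWord, Cycle.chain_map, Function.periodicOrbit_chain]
    intro m _
    rw [Function.iterate_succ_apply']
    exact h.follows _
  · have h1 : Function.minimalPeriod σ a = 1 := by
      rw [← length_cycleList σ ℓ a, ← Cycle.length_coe, coe_cycleList, hb]
      rfl
    have h2 : σ a = a := Function.minimalPeriod_eq_one_iff_isFixedPt.1 h1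
    have h3 : ℓ a = Letter.barred b := by
      rw [← coe_cycleList, cycleList, h1, Cycle.coe_eq_coe, List.isRotated_singleton_iff] at hb
      simpa [orbitWord] using hb
    have := ((h.isBarred_iff a).1 (by rw [h3]; rfl)).2
    rw [h2] at this
    exact lt_irrefl _ this

/-- A labelled permutation is standard if the order of the positions is given by the infinite words
of their labels and an index of their cycles. -/
theorem of_strictMono {I : Type*} [LinearOrder I] (idx : Fin n → I)
    (hidx : ∀ a, idx (σ a) = idx a)
    (hmono : StrictMono fun a => (toLex (rankWord σ ℓ a, idx a) : Lex (ℕ → ℤ ×ₗ ℤ) ×ₗ I))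
    (hf : ∀ a, Letter.Follows (ℓ a) (ℓ (σ a)))
    (hfix : ∀ a, σ a = a → (ℓ a).isBarred = false) : IsStandard σ ℓ := by
  have hlt : ∀ a b, a < b ↔ rankWord σ ℓ a < rankWord σ ℓ b ∨
      rankWord σ ℓ a = rankWord σ ℓ b ∧ idx a < idx b := by
    intro a b
    rw [← hmono.lt_iff_lt, Prod.Lex.lt_iff]
    rfl
  -- A constant orbit word gives `a` and `σ a` the same sort key.
  have hfixed : ∀ a, (∀ m, ℓ (σ^[m + 1] a) = ℓ (σ^[m] a)) → σ a = a := by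
    intro a ha
    apply hmono.injective
    have : orbitWord σ ℓ (σ a) = orbitWord σ ℓ a := funext fun m => ha m
    simp only [hidx, rankWord_eq_iff.2 this]
  have hfirst : ∀ a, σ a ≠ a → ∃ m, (∀ j ≤ m, ℓ (σ^[j] a) = ℓ a) ∧
      ℓ (σ^[m] a) ≠ ℓ (σ^[m + 1] a) := by
    intro a ha
    have hex : ∃ m, ℓ (σ^[m] a) ≠ ℓ (σ^[m + 1] a) := by
      by_contra hall
      push Not at hall
      exact ha (hfixed a fun m => (hall m).symm)
    classical
    refine ⟨Nat.find hex, fun j hj => ?_, Nat.find_spec hex⟩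
    induction j with
    | zero => rfl
    | succ j ih =>
      have := Nat.find_min hex (m := j) (by omega)
      rw [← ih (by omega)]
      exact (not_not.1 this).symm
  refine ⟨fun a b hab => ?_, fun a b hab he => ?_, fun a => ?_⟩
  · have hle : rankWord σ ℓ a ≤ rankWord σ ℓ b :=
      ((hlt a b).1 hab).elim le_of_lt fun h => h.1.le
    exact Pi.apply_le_of_toLex (i := 0) hle (by simp)
  · rw [hlt] at hab ⊢
    rw [hidx, hidx]
    refine hab.imp (fun h => ?_) fun h => ⟨?_, h.2⟩
    · rw [rankWord_lt_iff] at h ⊢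
      obtain ⟨i, h1, h2⟩ := h
      cases i with
      | zero => exact absurd h2 (by simp [he])
      | succ i => exact ⟨i, fun j hj => h1 (j + 1) (by omega), h2⟩
    · rw [rankWord_eq_iff] at h ⊢
      exact funext fun m => congrFun h.1 (m + 1)
  · constructor
    · intro hb
      refine ⟨Letter.color_of_isBarred hb, (hlt _ _).2 (Or.inl (rankWord_lt_iff.2 ?_))⟩
      obtain ⟨m, h1, h2⟩ := hfirst a fun h => by simp [hfix a h] at hb
      -- The words of `σ a` and `a` are shifts of each other, so they first differ at the first
      -- change of label, where the label before the change is still `ℓ a`.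
      refine ⟨m, fun j hj => (h1 j hj.le).trans (h1 (j + 1) hj).symm, ?_⟩
      have hf := hf (σ^[m] a)
      rw [← Function.iterate_succ_apply' σ] at hf
      exact Letter.rank_lt_of_follows_barred hf (by rw [h1 m le_rfl, hb]) h2
    · rintro ⟨hc, hlt'⟩
      by_contra hb
      rw [Bool.not_eq_true] at hb
      obtain ⟨m, h1, h2⟩ := hfirst a hlt'.ne'
      refine hlt'.not_gt ((hlt _ _).2 (Or.inl (rankWord_lt_iff.2 ?_)))
      refine ⟨m, fun j hj => (h1 (j + 1) hj).trans (h1 j hj.le).symm, ?_⟩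
      have hf := hf (σ^[m] a)
      rw [← Function.iterate_succ_apply' σ] at hf
      exact Letter.rank_lt_of_follows_unbarred hf (by rw [h1 m le_rfl, hb])
        (by rw [h1 m le_rfl, hc]) h2

end IsStandard

end ColoredEulerian

end

noncomputable section

namespace ColoredEulerian

variable {N n : ℕ}

/-! ### Every ornament comes from a standard labelled permutation -/

theorem exists_equiv_strictMono {α K : Type*} [Fintype α] [LinearOrder K] {key : α → K}
    (hkey : Function.Injective key) (hn : Fintype.card α = n) :
    ∃ e : Fin n ≃ α, StrictMono fun i => key (e i) := by
  let _ := LinearOrder.lift' key hkey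
  exact ⟨(Fintype.orderIsoFinOfCardEq α hn).toEquiv,
    fun a b hab => (Fintype.orderIsoFinOfCardEq α hn).strictMono hab⟩

theorem IsPrimitive.eq_of_periodic {w : List (Letter N)} (h : IsPrimitive (w : Cycle (Letter N)))
    {p q : ℕ} (hp : p < w.length) (hq : q < w.length)
    (heq : ∀ m, w[(p + m) % w.length]? = w[(q + m) % w.length]?) : p = q := by
  have hw : w ≠ [] := List.ne_nil_of_length_pos (by omega)
  rw [isPrimitive_coe_iff hw] at h
  have hrot : w.rotate p = w.rotate q := by
    apply List.ext_getElem?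
    intro m
    by_cases hm : m < w.length
    · rw [List.getElem?_rotate hm, List.getElem?_rotate hm, add_comm m, add_comm m, heq]
    · rw [List.getElem?_eq_none (by simpa using hm), List.getElem?_eq_none (by simpa using hm)]
  have key : ∀ p q, p < q → q < w.length → w.rotate p ≠ w.rotate q := by
    intro p q hpq hq he
    refine h (q - p) (by omega) (by omega) (List.rotate_eq_rotate (n := p) |>.1 ?_)
    rw [List.rotate_rotate, Nat.sub_add_cancel hpq.le, he]
  rcases lt_trichotomy p q with hpq | hpq | hpq
  · exact absurd hrot (key p q hpq hq)
  · exact hpq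
  · exact absurd hrot.symm (key q p hpq hp)

theorem Cycle.Chain.follows_getElem {α : Type*} {r : α → α → Prop} {w : List α}
    (h : (w : Cycle α).Chain r) {p : ℕ} (hp : p < w.length) :
    r w[p] (w[(p + 1) % w.length]'(Nat.mod_lt _ (by omega))) := by
  have hw : w ≠ [] := List.ne_nil_of_length_pos (by omega)
  obtain ⟨a, w, rfl⟩ := List.exists_cons_of_ne_nil hw
  rw [Cycle.chain_coe_cons, List.isChain_iff_getElem] at h
  have h := h p (by simpa using hp)
  simp only [← List.cons_append] at h
  rw [List.getElem_append_left hp] at h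
  convert h using 1
  rcases Nat.lt_or_ge (p + 1) (a :: w).length with hp' | hp'
  · rw [List.getElem_append_left hp']
    congr 1
    exact Nat.mod_eq_of_lt hp'
  · have hp'' : p + 1 = (a :: w).length := by omega
    rw [List.getElem_append_right hp']
    simp [hp'']

section Positions

variable {k : ℕ} (w : Fin k → List (Letter N))

/-- The positions in a sequence of circular words. -/
abbrev Position : Type := Σ t : Fin k, Fin (w t).length

variable {w}

/-- The cyclically next position. -/
def Position.next (x : Position w) : Position w :=
  ⟨x.1, ⟨(x.2 + 1) % (w x.1).length, Nat.mod_lt _ (by have := x.2.2; omega)⟩⟩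

theorem Position.iterate_next (x : Position w) (m : ℕ) : Position.next^[m] x =
    ⟨x.1, ⟨(x.2 + m) % (w x.1).length, Nat.mod_lt _ (by have := x.2.2; omega)⟩⟩ := by
  induction m with
  | zero =>
    obtain ⟨t, p⟩ := x
    simp [Nat.mod_eq_of_lt p.2]
  | succ m ih =>
    rw [Function.iterate_succ_apply', ih]
    simp [Position.next, add_assoc]

theorem Position.next_injective : Function.Injective (Position.next : Position w → Position w) := by
  refine Function.LeftInverse.injective
    (g := fun x => Position.next^[(w x.1).length - 1] x) fun x => ?_
  have hx := x.2.2
  have h : (w (Position.next x).1).length - 1 = (w x.1).length - 1 := rfl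
  simp only [h]
  rw [← Function.iterate_succ_apply, Position.iterate_next]
  obtain ⟨t, p⟩ := x
  simp only at hx ⊢
  congr 1
  apply Fin.ext
  simp only [Nat.succ_eq_add_one, Nat.sub_add_cancel (show 1 ≤ (w t).length by omega),
    Nat.add_mod_right, Nat.mod_eq_of_lt hx]

/-- The letter at a position. -/
def Position.letter (x : Position w) : Letter N := (w x.1)[x.2]

/-- Sort key of the positions: the infinite word read from a position, then the index of the
circular word. -/
def Position.key (x : Position w) : Lex (ℕ → ℤ ×ₗ ℤ) ×ₗ Fin k :=
  toLex (toLex fun m => (Position.next^[m] x).letter.rank, x.1)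

/-- The index separates different, possibly equal, circular words; within one word, primitivity
separates the starting points. -/
theorem Position.key_injective (hw : ∀ t, IsNecklace (w t : Cycle (Letter N))) :
    Function.Injective (Position.key : Position w → _) := by
  rintro ⟨t, p⟩ ⟨s, q⟩ h
  obtain ⟨h1, h2⟩ := Prod.mk.inj (toLex.injective h)
  obtain rfl : t = s := h2
  congr 1
  refine Fin.ext ((hw t).1.eq_of_periodic p.2 q.2 fun m => ?_)
  have := Letter.rank_injective (congrFun (toLex.injective h1) m)
  rw [Position.iterate_next, Position.iterate_next] at this
  rw [List.getElem?_eq_getElem (Nat.mod_lt _ (by have := p.2; omega)),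
    List.getElem?_eq_getElem (Nat.mod_lt _ (by have := p.2; omega))]
  exact congrArg some this

/-- Number the positions in increasing order of their keys and let `σ` move to the cyclically next
position. -/
theorem exists_isStandard_of_words (hw : ∀ t, IsNecklace (w t : Cycle (Letter N)))
    (hn : ∑ t, (w t).length = n) : ∃ (σ : Equiv.Perm (Fin n)) (ℓ : Fin n → Letter N),
      IsStandard σ ℓ ∧ cycleWords σ ℓ =
        (Finset.univ : Finset (Fin k)).val.map fun t => (w t : Cycle (Letter N)) := by
  obtain ⟨e, he⟩ := exists_equiv_strictMono (α := Position w) (n := n)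
    (Position.key_injective hw) (by simp [hn])
  let next : Equiv.Perm (Position w) := Equiv.ofBijective Position.next
    (Finite.injective_iff_bijective.1 Position.next_injective)
  let σ : Equiv.Perm (Fin n) := (e.trans next).trans e.symm
  let ℓ : Fin n → Letter N := fun a => (e a).letter
  have hσ : ∀ a, e (σ a) = (e a).next := fun a => e.apply_symm_apply _
  have hσm : ∀ a m, e (σ^[m] a) = Position.next^[m] (e a) := fun a m =>
    (Function.Semiconj.iterate_right (f := e) hσ m) a
  have hpos : ∀ t, 0 < (w t).length := fun t => List.length_pos_iff.2 (hw t).ne_nil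
  refine ⟨σ, ℓ, ?_, ?_⟩
  · refine IsStandard.of_strictMono (fun a => (e a).1) (fun a => by rw [hσ]; rfl) ?_ ?_ ?_
    · have hkey : ∀ a, toLex (rankWord σ ℓ a, (e a).1) = (e a).key := by
        intro a
        simp only [rankWord, Position.key, orbitWord, ℓ, hσm]
      simpa only [hkey] using he
    · intro a
      simp only [ℓ, hσ]
      exact Cycle.Chain.follows_getElem (hw (e a).1).2.1 (e a).2.2
    · intro a ha
      have ha' : (e a).next = e a := by rw [← hσ, ha]
      by_contra hb
      rw [Bool.not_eq_false] at hb
      generalize hx : e a = x at ha'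
      simp only [ℓ, hx] at hb
      obtain ⟨t, p⟩ := x
      -- A fixed point is a one-letter circular word, which condition (3) forbids to be barred.
      have hlen : (w t).length = 1 := by
        have hp := p.2
        simp only [Position.next, Sigma.mk.injEq, heq_eq_eq, true_and, Fin.ext_iff] at ha'
        rcases Nat.lt_or_ge (p + 1) (w t).length with h | h
        · rw [Nat.mod_eq_of_lt h] at ha'
          omega
        · have h : (p : ℕ) + 1 = (w t).length := by omega
          rw [h, Nat.mod_self] at ha'
          omega
      obtain ⟨x, hx⟩ := List.length_eq_one_iff.1 hlen
      have hxb : x.isBarred = true := by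
        have : Position.letter (⟨t, p⟩ : Position w) = x := by
          have hall : ∀ y ∈ w t, y = x := by simp [hx]
          exact hall _ (List.getElem_mem _)
        rwa [this] at hb
      cases x with
      | unbarred a m => simp [Letter.isBarred] at hxb
      | barred b => exact (hw t).2.2 b (by rw [hx])
  · rw [cycleWords_eq_of_transversal ℓ (fun t => e.symm ⟨t, ⟨0, hpos t⟩⟩)]
    · refine Multiset.map_congr rfl fun t _ => ?_
      rw [← coe_cycleList]
      set a := e.symm ⟨t, ⟨0, hpos t⟩⟩ with ha
      have hit : ∀ m, e (σ^[m] a) = ⟨t, ⟨m % (w t).length, Nat.mod_lt _ (hpos t)⟩⟩ := by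
        intro m
        rw [hσm, ha, Equiv.apply_symm_apply, Position.iterate_next]
        simp
      have hper : Function.minimalPeriod σ a = (w t).length := by
        apply Nat.dvd_antisymm
        · apply Function.IsPeriodicPt.minimalPeriod_dvd
          refine e.injective ?_
          rw [hit, ha, Equiv.apply_symm_apply]
          simp
        · have h1 := hit (Function.minimalPeriod σ a)
          rw [Function.iterate_minimalPeriod, ha, Equiv.apply_symm_apply, ← ha] at h1
          simp only [Sigma.mk.injEq, heq_eq_eq, true_and, Fin.mk.injEq] at h1
          exact Nat.dvd_of_mod_eq_zero h1.symm
      congr 1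
      apply List.ext_getElem
      · rw [length_cycleList, hper]
      · intro m _ hm
        have horb : orbitWord σ ℓ a m = (w t)[m % (w t).length]'(Nat.mod_lt _ (hpos t)) := by
          change (e (σ^[m] a)).letter = _
          rw [hit]
          rfl
        simp only [cycleList, List.getElem_map, List.getElem_range, horb, Nat.mod_eq_of_lt hm]
    · intro a
      refine ⟨(e a).1, sameCycle_iff_iterate.2 ⟨(e a).2, e.injective ?_⟩, fun s hs => ?_⟩
      · rw [hσm, Equiv.apply_symm_apply, Position.iterate_next]
        generalize e a = x
        obtain ⟨t, p⟩ := x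
        simp [Nat.mod_eq_of_lt p.2]
      · obtain ⟨m, rfl⟩ := sameCycle_iff_iterate.1 hs
        rw [hσm, Equiv.apply_symm_apply, Position.iterate_next]

end Positions

theorem exists_isStandard (R : Ornament N) (hn : (R.map fun c => c.1.length).sum = n) :
    ∃ (σ : Equiv.Perm (Fin n)) (ℓ : Fin n → Letter N),
      IsStandard σ ℓ ∧ cycleWords σ ℓ = R.map Subtype.val := by
  induction R using Quotient.inductionOn with
  | _ L =>
  rw [Multiset.quot_mk_to_coe, Multiset.map_coe, Multiset.sum_coe] at hn
  let w : Fin L.length → List (Letter N) := fun t => Quotient.out L[t].1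
  have hwc : ∀ t, (w t : Cycle (Letter N)) = L[t].1 := fun t => Quotient.out_eq _
  obtain ⟨σ, ℓ, h1, h2⟩ := exists_isStandard_of_words (w := w) (n := n)
    (fun t => by rw [hwc]; exact L[t].2) (by
      rw [← hn, ← List.ofFn_getElem_eq_map L fun c => c.1.length, List.sum_ofFn]
      refine Finset.sum_congr rfl fun t _ => ?_
      rw [← Cycle.length_coe, hwc]
      rfl)
  refine ⟨σ, ℓ, h1, ?_⟩
  rw [h2, Multiset.quot_mk_to_coe, Multiset.map_coe, ← List.ofFn_getElem_eq_map L Subtype.val,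
    Fin.univ_val_map]
  simp only [hwc]
  rfl

end ColoredEulerian

end

noncomputable section

namespace ColoredEulerian

variable {N n : ℕ} [NeZero N]

/-! ### Compatible sequences and standard labelled permutations -/

namespace ColoredPerm

theorem mem_EXC {π : ColoredPerm N n} {i : Fin n} :
    i ∈ EXC π ↔ (π.2 i : ℕ) = 0 ∧ i < π.1 i := by
  rw [EXC, Finset.mem_filter, letter, coloredInt, coloredInt, Prod.Lex.lt_iff]
  simp only [Finset.mem_univ, true_and, ofLex_toLex, OrderDual.toDual_lt_toDual,
    EmbeddingLike.apply_eq_iff_eq, Fin.not_lt_zero, false_or]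
  rw [eq_comm, Fin.ext_iff, Fin.val_zero]

/-- The letter at the position `i` of the labelled permutation given by `π` and a sequence `s`. -/
def label (π : ColoredPerm N n) (s : Fin n → ℕ+) (i : Fin n) : Letter N :=
  if i ∈ EXC π then Letter.barred (s i) else Letter.unbarred (s i) (π.2 i)

theorem abs_label (π : ColoredPerm N n) (s : Fin n → ℕ+) (i : Fin n) :
    (label π s i).abs = s i := by
  rw [label]
  split_ifs <;> rfl

theorem color_label (π : ColoredPerm N n) (s : Fin n → ℕ+) (i : Fin n) :
    (label π s i).color = π.2 i := by
  rw [label]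
  split_ifs with h
  · exact (mem_EXC.1 h).1.symm
  · rfl

theorem isBarred_label (π : ColoredPerm N n) (s : Fin n → ℕ+) (i : Fin n) :
    (label π s i).isBarred = true ↔ i ∈ EXC π := by
  rw [label]
  split_ifs with h <;> simp [h, Letter.isBarred]

theorem tilde_injective (π : ColoredPerm N n) : Function.Injective (tilde π) := by
  intro a b h
  apply π.1.injective
  rw [tilde, tilde] at h
  split_ifs at h with ha hb hb
  · exact Sum.inl_injective (toLex.injective h)
  · exact absurd (toLex.injective h) (by simp)
  · exact absurd (toLex.injective h) (by simp)
  · have := Sum.inr_injective (toLex.injective h)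
    exact (Prod.mk.inj (toLex.injective this)).2

/-- At equal values of `s`, `rank` reproduces the order of the tilde alphabet: tilde letters first,
then decreasing color, with ties left to `|π|`. -/
theorem tilde_lt_iff {π : ColoredPerm N n} {s : Fin n → ℕ+} {a b : Fin n} (hs : s a = s b) :
    tilde π a < tilde π b ↔ (label π s a).rank < (label π s b).rank ∨
      label π s a = label π s b ∧ π.1 a < π.1 b := by
  rw [Letter.rank_lt_iff, abs_label, abs_label, hs]
  by_cases ha : a ∈ EXC π <;> by_cases hb : b ∈ EXC π
  · simp [tilde, label, ha, hb, hs, Letter.isBarred]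
  · simp [tilde, label, ha, hb, Letter.isBarred]
  · simp [tilde, label, ha, hb, Letter.isBarred]
  · simp [tilde, label, ha, hb, hs, Letter.isBarred, Letter.color, letter, coloredInt,
      Prod.Lex.lt_iff]

/-- Since `s` is weakly decreasing, it is constant from `a` to `b`, and compatibility allows no
descent of `π̃` there. -/
theorem tilde_le_of_eq {π : ColoredPerm N n} {s : Fin n → ℕ+} (h : IsCompatible (DEX π) s)
    (d : ℕ) {a b : Fin n} (hd : (b : ℕ) = a + d) (hs : s a = s b) : tilde π a ≤ tilde π b := by
  induction d generalizing b with
  | zero => rw [show b = a from Fin.ext hd]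
  | succ d ih =>
    let c : Fin n := ⟨a + d, by have := b.2; omega⟩
    have hcn : (c : ℕ) + 1 < n := by have := b.2; simp only [c]; omega
    have hb : b = ⟨(c : ℕ) + 1, hcn⟩ := Fin.ext (by simp only [c]; omega)
    have h1 : s c ≤ s a := h.1 (Fin.le_def.2 (by simp [c]))
    have h2 : s b ≤ s c := h.1 (Fin.le_def.2 (by simp only [c]; omega))
    have hc : s a = s c := le_antisymm (hs.trans_le h2) h1
    refine (ih rfl hc).trans (not_lt.1 fun hlt => ?_)
    have h3 := h.2 c ⟨hcn, hb ▸ hlt⟩ hcn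
    rw [← hb, ← hs, hc] at h3
    exact lt_irrefl _ h3

/-- Compatibility says that `s` is weakly decreasing and `π̃` strictly increasing on each block of
constant `s`. By `tilde_lt_iff` these are the two order conditions of standardness; the condition on
bars is built into `label`. -/
theorem isCompatible_iff_isStandard {π : ColoredPerm N n} {s : Fin n → ℕ+} :
    IsCompatible (DEX π) s ↔ IsStandard π.1 (label π s) := by
  constructor
  · intro h
    have hlt : ∀ a b, a < b → s a = s b → tilde π a < tilde π b := fun a b hab hs =>
      lt_of_le_of_ne (tilde_le_of_eq h (b - a) (by have : (a : ℕ) < b := hab; omega) hs)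
        ((tilde_injective π).ne hab.ne)
    refine ⟨fun a b hab => ?_, fun a b hab he => ?_, fun a => ?_⟩
    · rcases (h.1 hab.le).lt_or_eq with hs | hs
      · exact le_of_lt (Letter.rank_lt_iff.2 (Or.inl (by rwa [abs_label, abs_label])))
      · rcases (tilde_lt_iff hs.symm).1 (hlt a b hab hs.symm) with h | h
        · exact h.le
        · rw [h.1]
    · have hs : s a = s b := by rw [← abs_label π s a, he, abs_label]
      rcases (tilde_lt_iff hs).1 (hlt a b hab hs) with h | h
      · rw [he] at h
        exact absurd h (lt_irrefl _)
      · exact h.2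
    · rw [isBarred_label, color_label, mem_EXC]
  · intro h
    have hanti : Antitone s := antitone_iff_forall_lt.2 fun a b hab => by
      have := Letter.abs_le_of_rank_le (h.rank_le a b hab)
      rwa [abs_label, abs_label] at this
    refine ⟨hanti, fun i ⟨_, hi⟩ hn => ?_⟩
    have hii : i < ⟨(i : ℕ) + 1, hn⟩ := Fin.lt_def.2 (Nat.lt_succ_self _)
    refine lt_of_le_of_ne (hanti hii.le) fun hs => hi.not_gt ((tilde_lt_iff hs.symm).2 ?_)
    rcases (h.rank_le _ _ hii).lt_or_eq with hlt | heq
    · exact Or.inl hlt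
    · have heq := Letter.rank_injective heq
      exact Or.inr ⟨heq, h.apply_lt _ _ hii heq⟩

theorem exists_label_eq {σ : Equiv.Perm (Fin n)} {ℓ : Fin n → Letter N} (h : IsStandard σ ℓ) :
    ∃ (ε : Fin n → Fin N) (s : Fin n → ℕ+), label (σ, ε) s = ℓ := by
  have hc : ∀ i, (ℓ i).color < N := by
    intro i
    cases hb : (ℓ i).isBarred
    · exact Letter.color_lt hb
    · rw [Letter.color_of_isBarred hb]
      exact Nat.pos_of_neZero N
  refine ⟨fun i => ⟨(ℓ i).color, hc i⟩, fun i => (ℓ i).abs, funext fun i => ?_⟩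
  refine Letter.ext_of (abs_label _ _ i) (color_label _ _ i) ?_
  rw [Bool.eq_iff_iff, isBarred_label, mem_EXC, h.isBarred_iff]

theorem eq_of_label_eq {σ : Equiv.Perm (Fin n)} {ε ε' : Fin n → Fin N} {s s' : Fin n → ℕ+}
    (h : label (σ, ε) s = label (σ, ε') s') : ε = ε' ∧ s = s' := by
  refine ⟨funext fun i => Fin.ext ?_, funext fun i => ?_⟩
  · have h1 := color_label (σ, ε) s i
    rw [h, color_label] at h1
    exact h1.symm
  · rw [← abs_label (σ, ε) s i, h, abs_label]

end ColoredPerm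

open ColoredPerm (label)

/-! ### The statistics of the ornament of a labelled permutation -/

variable {R : Ornament N} {π : ColoredPerm N n} {s : Fin n → ℕ+}

theorem weight_of_cycleWords_eq (h : R.map Subtype.val = cycleWords π.1 (label π s)) :
    R.weight = ∏ i, MvPowerSeries.X (s i) := by
  rw [Ornament.weight_eq, h, ← wt_bind, ← univ_map_eq_bind_cycleWords, wt, Multiset.map_map]
  simp only [Function.comp_def, ColoredPerm.abs_label]
  rfl

theorem numBars_of_cycleWords_eq (h : R.map Subtype.val = cycleWords π.1 (label π s)) :
    R.numBars = π.exc := by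
  rw [Ornament.numBars_eq, h, ← bars_bind, ← univ_map_eq_bind_cycleWords, bars, Multiset.countP_map]
  simp only [ColoredPerm.isBarred_label]
  rw [← Finset.filter_val, Finset.card_val, Finset.filter_univ_mem]
  rfl

theorem cvCycleType_of_cycleWords_eq (h : R.map Subtype.val = cycleWords π.1 (label π s)) :
    R.cvCycleType = π.cvCycleType := by
  rw [Ornament.cvCycleType_eq, h, ← Function.comp_def lengthCol, ← Multiset.map_map,
    map_toMultiset_cycleWords, Multiset.map_map,
    ColoredPerm.cvCycleType]
  refine Multiset.map_congr rfl fun c _ => ?_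
  simp only [Function.comp_apply, lengthCol, Multiset.card_map, Finset.card_val,
    Multiset.countP_map, ColoredPerm.color_label]
  rfl

/-- The pairs of a colored permutation `π` of cv-cycle type `lam` with `j` excedances and a
`DEX(π)`-compatible sequence. -/
def compatiblePairs (n : ℕ) (lam : Multiset (ℕ × (Fin (N - 1) → ℕ))) (j : ℕ) :
    Set (ColoredPerm N n × (Fin n → ℕ+)) :=
  {p | IsCompatible p.1.DEX p.2 ∧ p.1.cvCycleType = lam ∧ p.1.exc = j}

/-- Pairs are standard labelled permutations in disguise, and these are determined by their circular
words, which can form any ornament of total length `n`. -/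
theorem exists_compatiblePairs_equiv_ornaments (lam : Multiset (ℕ × (Fin (N - 1) → ℕ))) (j : ℕ) :
    ∃ e : compatiblePairs (lam.map Prod.fst).sum lam j ≃ ornaments lam j,
      ∀ p, (e p).1.weight = ∏ i, MvPowerSeries.X (p.1.2 i) := by
  have hex : ∀ p : compatiblePairs (lam.map Prod.fst).sum lam j, ∃ R : Ornament N,
      R.map Subtype.val = cycleWords p.1.1.1 (label p.1.1 p.1.2) := by
    intro p
    have hst := ColoredPerm.isCompatible_iff_isStandard.1 p.2.1
    have hn : ∀ c ∈ cycleWords p.1.1.1 (label p.1.1 p.1.2), IsNecklace c := by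
      intro c hc
      obtain ⟨a, rfl⟩ := mem_cycleWords.1 hc
      exact hst.isNecklace_cycleWord a
    refine ⟨Multiset.pmap Subtype.mk _ hn, ?_⟩
    rw [Multiset.map_pmap]
    exact (Multiset.pmap_eq_map _ _ _ _).trans (Multiset.map_id' _)
  choose f hf using hex
  let g : compatiblePairs (lam.map Prod.fst).sum lam j → ornaments lam j := fun p =>
    ⟨f p, (cvCycleType_of_cycleWords_eq (hf p)).trans p.2.2.1,
      (numBars_of_cycleWords_eq (hf p)).trans p.2.2.2⟩
  have hg : Function.Bijective g := by
    constructor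
    · rintro p q hpq
      have hpq : f p = f q := congrArg Subtype.val hpq
      have h := (hf p).symm.trans ((congrArg _ hpq).trans (hf q))
      obtain ⟨h1, h2⟩ := (ColoredPerm.isCompatible_iff_isStandard.1 p.2.1).eq_of_cycleWords_eq
        (ColoredPerm.isCompatible_iff_isStandard.1 q.2.1) h
      obtain ⟨⟨⟨σ, ε⟩, s⟩, hp⟩ := p
      obtain ⟨⟨⟨τ, ε'⟩, s'⟩, hq⟩ := q
      obtain rfl : σ = τ := h1
      obtain ⟨rfl, rfl⟩ := ColoredPerm.eq_of_label_eq h2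
      rfl
    · rintro ⟨R, hR, hj⟩
      have hn : (R.map fun c => c.1.length).sum = (lam.map Prod.fst).sum := by
        rw [← hR, Ornament.cvCycleType, Multiset.map_map]
        simp [lengthCol]
      obtain ⟨σ, ℓ, hst, hRw⟩ := exists_isStandard R hn
      obtain ⟨ε, s, rfl⟩ := ColoredPerm.exists_label_eq hst
      refine ⟨⟨((σ, ε), s), ColoredPerm.isCompatible_iff_isStandard.2 hst,
        (cvCycleType_of_cycleWords_eq (π := (σ, ε)) hRw.symm).symm.trans hR,
        (numBars_of_cycleWords_eq (π := (σ, ε)) hRw.symm).symm.trans hj⟩, Subtype.ext ?_⟩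
      exact Multiset.map_injective Subtype.val_injective ((hf _).trans hRw)
  exact ⟨Equiv.ofBijective g hg, fun p => weight_of_cycleWords_eq (hf p)⟩

theorem hasSum_compatiblePairs (lam : Multiset (ℕ × (Fin (N - 1) → ℕ))) (j : ℕ) :
    HasSum (fun p : compatiblePairs (lam.map Prod.fst).sum lam j =>
      (∏ i, MvPowerSeries.X (p.1.2 i) : MvPowerSeries ℕ+ ℤ)) (Q N lam j) := by
  set n := (lam.map Prod.fst).sum with hn
  let F : ColoredPerm N n × (Fin n → ℕ+) → MvPowerSeries ℕ+ ℤ :=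
    fun p => ∏ i, MvPowerSeries.X (p.2 i)
  let t : ColoredPerm N n → Set (ColoredPerm N n × (Fin n → ℕ+)) :=
    fun π => {p | p.1 = π ∧ IsCompatible π.DEX p.2}
  let P : Finset (ColoredPerm N n) :=
    Finset.univ.filter fun π => π.cvCycleType = lam ∧ π.exc = j
  -- The pairs split into finitely many disjoint blocks, one for each `π`, and each block sums to a
  -- fundamental quasisymmetric function.
  have hsum : HasSum (F ∘ (↑) : (⋃ π ∈ P, t π) → MvPowerSeries ℕ+ ℤ)
      (∑ π ∈ P, fundamental n π.DEX) := by
    refine hasSum_sum_disjoint P (fun π _ ρ _ hne => ?_) fun π _ => ?_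
    · exact Set.disjoint_left.2 fun p hp hp' => hne (hp.1.symm.trans hp'.1)
    · let e : {s : Fin n → ℕ+ // IsCompatible π.DEX s} ≃ t π :=
        { toFun := fun s => ⟨(π, s.1), rfl, s.2⟩
          invFun := fun p => ⟨p.1.2, p.2.2⟩
          left_inv := fun s => rfl
          right_inv := by
            rintro ⟨⟨ρ, s⟩, rfl, hs⟩
            rfl }
      rw [← e.hasSum_iff]
      exact (summable_fundamental n π.DEX).hasSum
  have hset : (⋃ π ∈ P, t π) = compatiblePairs n lam j := by
    ext p
    simp only [Set.mem_iUnion, P, Finset.mem_filter, Finset.mem_univ, true_and, t,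
      Set.mem_ofPred_eq, compatiblePairs, exists_prop]
    constructor
    · rintro ⟨π, h, rfl, hc⟩
      exact ⟨hc, h⟩
    · rintro ⟨hc, h⟩
      exact ⟨p.1, h, rfl, hc⟩
  rw [hset] at hsum
  exact hsum

end ColoredEulerian

end

theorem theorem4p4 (N : ℕ) [NeZero N] (lam : Multiset (ℕ × (Fin (N - 1) → ℕ))) (j : ℕ) :
    (∃ e : ColoredEulerian.ornaments lam j ≃ ColoredEulerian.banners lam j,
      ∀ R : ColoredEulerian.ornaments lam j,
        ColoredEulerian.wt ((e R).1 : Multiset (ColoredEulerian.Letter N)) =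
          ColoredEulerian.Ornament.weight R.1) ∧
    HasSum
      (fun B : ColoredEulerian.banners lam j =>
        ColoredEulerian.wt (B.1 : Multiset (ColoredEulerian.Letter N)))
      (ColoredEulerian.Q N lam j) := by
  obtain ⟨e, he⟩ := ColoredEulerian.exists_ornaments_equiv_banners lam j
  refine ⟨⟨e, he⟩, ?_⟩
  obtain ⟨f, hf⟩ := ColoredEulerian.exists_compatiblePairs_equiv_ornaments lam j
  rw [← (f.trans e).hasSum_iff]
  convert ColoredEulerian.hasSum_compatiblePairs lam j using 2 with p
  rw [← hf p, ← he (f p)]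
  rfl
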